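/- Throughout, operators are bounded linear maps on complex Hilbert spaces, $\mathbb{C}^2$ carries its Euclidean norm, and norms of operators are operator norms. A tuple $(T_1,\dots,T_k)$ of operators is \emph{anti-commuting} if $T_iT_j=-T_jT_i$ for $1\le i<j\le k$. It is \emph{$q$-commuting}, for a family $q=\{q_{ij}\}$ of complex numbers with $|q_{ij}|=1$ and $q_{ij}=q_{ji}^{-1}$, if $T_iT_j=q_{ij}T_jT_i$ for $1\le i<j\le k$. A tuple $(N_1,\dots,N_k)$ on a Hilbert space $\mathcal K$ \emph{dilates} a tuple $(T_1,\dots,T_k)$ on a Hilbert space $\mathcal H$ if there is a linear isometry $V:\mathcal H\to\mathcal K$ with $$T_1^{m_1}\cdots T_k^{m_k}=V^*N_1^{m_1}\cdots N_k^{m_k}V\qquad\text{for all integers } m_1,\dots,m_k\ge 0 .$$ \textbf{Theorem.} Let $k\ge 1$ and let $(T_1,\dots,T_k)$ be an anti-commuting $k$-tuple of contractions on $\mathbb{C}^2$. (0) If $T_1\neq 0$ (in particular, if all $T_j$ are non-zero), then there exist a Hilbert space $\mathcal K$, a $q$-commuting tuple $(U_1,\dots,U_k)$ of unitaries on $\mathcal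 K$ with $q\subseteq\{1,-1\}$, and a scalar $\beta\neq 0$ such that $(\beta U_1,U_2,\dots,U_k)$ dilates $(T_1,\dots,T_k)$. (1) If some $T_j$ is non-zero and non-invertible, then $(T_1,\dots,T_k)$ is dilated by a $q$-commuting tuple of unitaries with $q\subseteq\{1,-1\}$. (2) If $T_1,\dots,T_k$ are all invertible, then $k\le 3$. If moreover $k=3$ and $\|T_1\|\le\|T_2T_3\|$, then $(T_1,T_2,T_3)$ is dilated by an anti-commuting triple of unitaries. -/

import Mathlib

/-- An anti-commuting tuple of operators: `T i * T j = - T j * T i` for `i < j`. -/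
def IsAntiCommuting {k : ℕ} {H : Type*} [NormedAddCommGroup H] [InnerProductSpace ℂ H]
    (T : Fin k → H →L[ℂ] H) : Prop :=
  ∀ i j : Fin k, i < j → T i * T j = -(T j * T i)

/-- A tuple of operators that is `q`-commuting, where `q` is a family of unimodular scalars with
`q i j = (q j i)⁻¹`. -/
def IsQCommuting {k : ℕ} {H : Type*} [NormedAddCommGroup H] [InnerProductSpace ℂ H]
    (q : Fin k → Fin k → ℂ) (T : Fin k → H →L[ℂ] H) : Prop :=
  ∀ i j : Fin k, i < j → ‖q i j‖ = 1 ∧ q i j = (q j i)⁻¹ ∧ T i * T j = q i j • (T j * T i)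

/-- The condition `q ⊆ {1, -1}`. -/
def IsSignFamily {k : ℕ} (q : Fin k → Fin k → ℂ) : Prop :=
  ∀ i j : Fin k, i < j → q i j = 1 ∨ q i j = -1

/-- The ordered product `T 0 ^ m 0 * T 1 ^ m 1 * ⋯ * T (k - 1) ^ m (k - 1)`. -/
def orderedMonomial {k : ℕ} {H : Type*} [NormedAddCommGroup H] [InnerProductSpace ℂ H]
    (T : Fin k → H →L[ℂ] H) (m : Fin k → ℕ) : H →L[ℂ] H :=
  (List.ofFn fun i => T i ^ m i).prod

/-- The tuple `N` on `K` dilates the tuple `T` on `H`: for some isometry `V : H → K`, every ordered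
monomial in `T` is the compression by `V` of the same ordered monomial in `N`. -/
def Dilates {k : ℕ} {H K : Type*} [NormedAddCommGroup H] [InnerProductSpace ℂ H] [CompleteSpace H]
    [NormedAddCommGroup K] [InnerProductSpace ℂ K] [CompleteSpace K]
    (N : Fin k → K →L[ℂ] K) (T : Fin k → H →L[ℂ] H) : Prop :=
  ∃ V : H →ₗᵢ[ℂ] K, ∀ m : Fin k → ℕ,
    orderedMonomial T m =
      (ContinuousLinearMap.adjoint V.toContinuousLinearMap).comp
        ((orderedMonomial N m).comp V.toContinuousLinearMap)

/-! In dimension two, anti-commutation leaves so little room that every tuple in question consists,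
up to scalar factors, of words `a`, `b`, `ab` in just two anti-commuting contractions. Suppose a
non-zero entry `A` is singular. If `A² ≠ 0`, at most one other entry is non-zero
(`eq_zero_or_eq_zero_of_sq_ne_zero`); if `A² = 0`, all entries but at most one are multiples of `A`
(`eq_smul_or_eq_smul_of_sq_eq_zero`). If all non-zero entries are invertible, a third is a multiple
of the product of the other two (`eq_smul_mul_of_anticomm`), and there is no fourth.

Dilating such a tuple takes three steps. An Andô-type construction dilates a pair with `AB = εBA`,
`ε² = 1`, to unitaries with the same relation (`exists_unitary_dilation_pair`). Words come for free:
an ordered monomial in words reduces to `σ aᵖ bʳ`, with `σ`, `p`, `r` depending only on `ε`, the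
words and the exponents, so the same reduction holds for the contractions and for the unitaries
(`unitarilyDilated_eval`). Scalar factors of modulus at most one are dilated by bilateral shifts
that commute with everything else (`UnitarilyDilated.smul`).

Only in the relation `T₁ = β TᵢTₗ` between invertible entries can a scalar exceed one in modulus.
This is the `β` of part (0), and the norm hypothesis of part (2) is exactly what bounds it by one.
-/

open Filter Topology

/-! ### Extending ε-commuting isometries to ε-commuting unitaries by a direct limit -/

section UnitaryExtension

variable {X : Type} [NormedAddCommGroup X] [InnerProductSpace ℂ X]

/-- Sequences that are eventually orbits of `V`. -/
def eventualOrbitSubmodule (V : X →ₗᵢ[ℂ] X) : Submodule ℂ (ℕ → X) where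
  carrier := {x | ∀ᶠ n in atTop, x (n + 1) = V (x n)}
  zero_mem' := by simp
  add_mem' := by
    intro x y hx hy
    filter_upwards [hx, hy] with n h1 h2
    simp [h1, h2]
  smul_mem' := by
    intro c x hx
    filter_upwards [hx] with n h1
    simp [h1]

/-- The type of sequences that are eventually orbits of `V`. -/
def EventualOrbit (V : X →ₗᵢ[ℂ] X) : Type := eventualOrbitSubmodule V

namespace EventualOrbit

variable (V : X →ₗᵢ[ℂ] X)

noncomputable instance : AddCommGroup (EventualOrbit V) :=
  inferInstanceAs (AddCommGroup (eventualOrbitSubmodule V))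

noncomputable instance : Module ℂ (EventualOrbit V) :=
  inferInstanceAs (Module ℂ (eventualOrbitSubmodule V))

variable {V}

/-- The terms of an eventual orbit. -/
def seq (x : EventualOrbit V) : ℕ → X := Subtype.val (p := (· ∈ eventualOrbitSubmodule V)) x

theorem seq_spec (x : EventualOrbit V) : ∀ᶠ n in atTop, x.seq (n + 1) = V (x.seq n) :=
  Subtype.property (p := (· ∈ eventualOrbitSubmodule V)) x

/-- An eventual orbit from its terms. -/
def ofSeq (x : ℕ → X) (hx : ∀ᶠ n in atTop, x (n + 1) = V (x n)) : EventualOrbit V :=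
  (⟨x, hx⟩ : eventualOrbitSubmodule V)

@[simp] theorem seq_ofSeq (x : ℕ → X) (hx) : (ofSeq x hx : EventualOrbit V).seq = x := rfl
@[simp] theorem seq_add (x y : EventualOrbit V) (n : ℕ) :
    (x + y).seq n = x.seq n + y.seq n := rfl
@[simp] theorem seq_smul (c : ℂ) (x : EventualOrbit V) (n : ℕ) :
    (c • x).seq n = c • x.seq n := rfl

theorem seq_ext {x y : EventualOrbit V} (h : ∀ n, x.seq n = y.seq n) : x = y :=
  Subtype.ext (p := (· ∈ eventualOrbitSubmodule V)) (funext h)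

/-- Once both sequences follow `V`, which preserves inner products, the sequence of inner products
is constant. -/
theorem exists_eventually_inner_eq (x y : EventualOrbit V) :
    ∃ c : ℂ, ∀ᶠ n in atTop, inner ℂ (x.seq n) (y.seq n) = c := by
  obtain ⟨N, hN⟩ := eventually_atTop.1 (x.seq_spec.and y.seq_spec)
  refine ⟨inner ℂ (x.seq N) (y.seq N), eventually_atTop.2 ⟨N, fun n hn => ?_⟩⟩
  induction n, hn using Nat.le_induction with
  | base => rfl
  | succ n hn ih => rw [(hN n hn).1, (hN n hn).2, V.inner_map_map, ih]

/-- The limit of the inner products of the terms. -/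
noncomputable def limInner (x y : EventualOrbit V) : ℂ :=
  (exists_eventually_inner_eq x y).choose

theorem limInner_spec (x y : EventualOrbit V) :
    ∀ᶠ n in atTop, inner ℂ (x.seq n) (y.seq n) = limInner x y :=
  (exists_eventually_inner_eq x y).choose_spec

theorem limInner_eq {x y : EventualOrbit V} {c : ℂ}
    (h : ∀ᶠ n in atTop, inner ℂ (x.seq n) (y.seq n) = c) : limInner x y = c := by
  obtain ⟨n, h1, h2⟩ := (h.and (limInner_spec x y)).exists
  rw [← h1, ← h2]

/-- The form is only semidefinite: sequences that are eventually zero are null vectors. Completion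
later identifies sequences with the same tail. -/
noncomputable instance preCore : PreInnerProductSpace.Core ℂ (EventualOrbit V) where
  inner := limInner
  conj_inner_symm x y := by
    symm
    apply limInner_eq
    filter_upwards [limInner_spec y x] with n h
    rw [← h, inner_conj_symm]
  re_inner_nonneg x := by
    obtain ⟨n, h⟩ := (limInner_spec x x).exists
    rw [← h]
    exact inner_self_nonneg
  add_left x y z := by
    apply limInner_eq
    filter_upwards [limInner_spec x z, limInner_spec y z] with n h1 h2
    rw [← h1, ← h2, seq_add, inner_add_left]
  smul_left x y r := by
    apply limInner_eq
    filter_upwards [limInner_spec x y] with n h1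
    rw [← h1, seq_smul, inner_smul_left]

noncomputable instance : SeminormedAddCommGroup (EventualOrbit V) :=
  InnerProductSpace.Core.toSeminormedAddCommGroup (𝕜 := ℂ)

noncomputable instance : InnerProductSpace ℂ (EventualOrbit V) :=
  InnerProductSpace.ofCore preCore

theorem inner_def (x y : EventualOrbit V) : inner ℂ x y = limInner x y := rfl

theorem norm_eq {x : EventualOrbit V} {r : ℝ} (h : ∀ᶠ n in atTop, ‖x.seq n‖ = r) : ‖x‖ = r := by
  obtain ⟨n, h1⟩ := h.exists
  have hr : 0 ≤ r := h1 ▸ norm_nonneg _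
  have : ((‖x‖ ^ 2 : ℝ) : ℂ) = (r ^ 2 : ℝ) := by
    have := inner_self_eq_norm_sq_to_K (𝕜 := ℂ) x
    push_cast
    erw [← this, inner_def]
    apply limInner_eq
    filter_upwards [h] with n hn
    rw [inner_self_eq_norm_sq_to_K, hn]
    rfl
  have h2 : ‖x‖ ^ 2 = r ^ 2 := by exact_mod_cast this
  exact (sq_eq_sq₀ (norm_nonneg _) hr).1 h2

theorem norm_eq_norm {x y : EventualOrbit V} (h : ∀ᶠ n in atTop, ‖x.seq n‖ = ‖y.seq n‖) :
    ‖x‖ = ‖y‖ := by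
  obtain ⟨N, hN⟩ := eventually_atTop.1 y.seq_spec
  have h1 : ∀ n, N ≤ n → ‖y.seq n‖ = ‖y.seq N‖ := fun n hn => by
    induction n, hn using Nat.le_induction with
    | base => rfl
    | succ n hn ih => rw [hN n hn, V.norm_map, ih]
  rw [norm_eq (r := ‖y.seq N‖) (x := y) (eventually_atTop.2 ⟨N, h1⟩)]
  apply norm_eq
  filter_upwards [h, eventually_ge_atTop N] with n h2 h3
  rw [h2, h1 n h3]

end EventualOrbit

theorem LinearIsometry.exists_extension {M K : Type} [SeminormedAddCommGroup M]
    [InnerProductSpace ℂ M] [NormedAddCommGroup K] [InnerProductSpace ℂ K] [CompleteSpace K]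
    (ι : M →ₗᵢ[ℂ] K) (hι : DenseRange ι) (f : M →ₗᵢ[ℂ] M) :
    ∃ g : K →ₗᵢ[ℂ] K, ∀ x, g (ι x) = ι (f x) := by
  let g : K →L[ℂ] K := (ι.comp f).toContinuousLinearMap.extend ι.toContinuousLinearMap
  have hg : ∀ x, g (ι x) = ι (f x) :=
    ContinuousLinearMap.extend_eq _ hι ι.isometry.isUniformInducing
  refine ⟨⟨g.toLinearMap, fun x => ?_⟩, hg⟩
  refine hι.induction_on (p := fun x => ‖g x‖ = ‖x‖) x
    (isClosed_eq g.continuous.norm continuous_norm) fun a => ?_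
  rw [hg, ι.norm_map, ι.norm_map, f.norm_map]

namespace EventualOrbit

/-- The factor `ε ^ n` absorbs the sign that appears each time `S` is moved past `V`. -/
theorem eventually_twist {V : X →ₗᵢ[ℂ] X} (S : X →ₗᵢ[ℂ] X) (ε : ℂ) (hε : ε * ε = 1)
    (h : ∀ x, S (V x) = ε • V (S x)) (x : EventualOrbit V) :
    ∀ᶠ n in atTop, ε ^ (n + 1) • S (x.seq (n + 1)) = V (ε ^ n • S (x.seq n)) := by
  filter_upwards [x.seq_spec] with n hn
  rw [hn, h, smul_smul, map_smul, pow_succ, mul_assoc, hε, mul_one]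

/-- A linear isometry that commutes with `V` up to the sign `ε` acts on eventual orbits. -/
noncomputable def twist {V : X →ₗᵢ[ℂ] X} (S : X →ₗᵢ[ℂ] X) (ε : ℂ) (hε : ε * ε = 1)
    (h : ∀ x, S (V x) = ε • V (S x)) : EventualOrbit V →ₗᵢ[ℂ] EventualOrbit V where
  toFun x := ofSeq (fun n => ε ^ n • S (x.seq n)) (eventually_twist S ε hε h x)
  map_add' x y := seq_ext fun n => by
    rw [seq_add]
    simp only [seq_ofSeq, seq_add, map_add, smul_add]
  map_smul' c x := seq_ext fun n => by
    rw [seq_smul]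
    simp only [seq_ofSeq, seq_smul, map_smul, RingHom.id_apply]
    rw [smul_comm]
  norm_map' x := norm_eq_norm <| Eventually.of_forall fun n => by
    have : ‖ε‖ = 1 := by
      have := congrArg norm hε
      rw [norm_mul, norm_one] at this
      nlinarith [norm_nonneg ε]
    change ‖ε ^ n • S (x.seq n)‖ = _
    rw [norm_smul, norm_pow, this, one_pow, one_mul, S.norm_map]

@[simp] theorem seq_twist {V : X →ₗᵢ[ℂ] X} (S : X →ₗᵢ[ℂ] X) (ε : ℂ) (hε : ε * ε = 1)
    (h : ∀ x, S (V x) = ε • V (S x)) (x : EventualOrbit V) (n : ℕ) :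
    (twist S ε hε h x).seq n = ε ^ n • S (x.seq n) := rfl

theorem eventually_orbit (V : X →ₗᵢ[ℂ] X) (x : X) :
    ∀ᶠ n in atTop, (V ^ (n + 1)) x = V ((V ^ n) x) :=
  Eventually.of_forall fun n => by rw [pow_succ']; rfl

/-- The orbit of a vector. -/
noncomputable def orbit (V : X →ₗᵢ[ℂ] X) : X →ₗᵢ[ℂ] EventualOrbit V where
  toFun x := ofSeq (fun n => (V ^ n) x) (eventually_orbit V x)
  map_add' _ _ := seq_ext fun _ => map_add _ _ _
  map_smul' _ _ := seq_ext fun _ => map_smul _ _ _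
  norm_map' _ := norm_eq <| Eventually.of_forall fun _ => LinearIsometry.norm_map _ _

end EventualOrbit

open EventualOrbit in
/-- Two isometries that commute up to a sign extend to unitaries that commute up to that sign. -/
theorem exists_unitary_extension (V₁ V₂ : X →ₗᵢ[ℂ] X) (ε : ℂ) (hε : ε * ε = 1)
    (h : ∀ x, V₁ (V₂ x) = ε • V₂ (V₁ x)) :
    ∃ (K : Type) (_ : NormedAddCommGroup K) (_ : InnerProductSpace ℂ K) (_ : CompleteSpace K)
      (J : X →ₗᵢ[ℂ] K) (U₁ U₂ : K ≃ₗᵢ[ℂ] K),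
      (∀ x, U₁ (J x) = J (V₁ x)) ∧ (∀ x, U₂ (J x) = J (V₂ x)) ∧
        ∀ x, U₁ (U₂ x) = ε • U₂ (U₁ x) := by
  -- Inverting the product inverts both factors, so a single direct limit along `V₁V₂` suffices.
  obtain ⟨V, hV⟩ : ∃ V : X →ₗᵢ[ℂ] X, ∀ x, V x = V₁ (V₂ x) := ⟨V₁.comp V₂, fun _ => rfl⟩
  have h' : ∀ x, V₂ (V₁ x) = ε • V₁ (V₂ x) := fun x => by rw [h, smul_smul, hε, one_smul]
  have h1 : ∀ x, V₁ (V x) = ε • V (V₁ x) := fun x => by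
    rw [hV, hV, h' x, map_smul, smul_smul, hε, one_smul]
  have h2 : ∀ x, V₂ (V x) = ε • V (V₂ x) := fun x => by
    rw [hV, hV, h' (V₂ x)]
  let S₁ := twist V₁ ε hε h1
  let S₂ := twist V₂ ε hε h2
  have hS : ∀ x, S₁ (S₂ x) = ε • S₂ (S₁ x) := fun x => seq_ext fun n => by
    simp only [S₁, S₂, seq_twist, map_smul, seq_smul, h, smul_smul]
    ring_nf
  obtain ⟨K, _, _, _, ι, hι⟩ : ∃ (K : Type) (_ : NormedAddCommGroup K) (_ : InnerProductSpace ℂ K)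
      (_ : CompleteSpace K) (ι : EventualOrbit V →ₗᵢ[ℂ] K), DenseRange ι :=
    ⟨UniformSpace.Completion (EventualOrbit V), inferInstance, inferInstance, inferInstance,
      UniformSpace.Completion.toComplₗᵢ, UniformSpace.Completion.denseRange_coe⟩
  obtain ⟨W₁, hW₁⟩ := ι.exists_extension hι S₁
  obtain ⟨W₂, hW₂⟩ := ι.exists_extension hι S₂
  have hW : ∀ x, W₁ (W₂ x) = ε • W₂ (W₁ x) := fun x => by
    refine hι.induction_on (p := fun x => W₁ (W₂ x) = ε • W₂ (W₁ x)) x (isClosed_eq ?_ ?_)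
      fun a => ?_
    · exact W₁.continuous.comp W₂.continuous
    · exact (W₂.continuous.comp W₁.continuous).const_smul ε
    · rw [hW₁, hW₂, hW₁, hW₂, hS, map_smul]
  have hdense : ∀ a : EventualOrbit V, ∃ y, W₁ (W₂ y) = ι a := fun a => by
    have hb : ∀ᶠ n in atTop, a.seq (n + 1 - 1) = V (a.seq (n - 1)) := by
      obtain ⟨N, hN⟩ := eventually_atTop.1 a.seq_spec
      refine eventually_atTop.2 ⟨N + 1, fun n hn => ?_⟩
      obtain ⟨m, rfl⟩ : ∃ m, n = m + 1 := ⟨n - 1, by omega⟩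
      simpa using hN m (by omega)
    -- On terms, `S₁S₂` acts as `V` because the two factors `ε ^ n` cancel. Delaying `a` by one step
    -- therefore gives a preimage of `a`; the truncated `0 - 1` affects only an initial term.
    refine ⟨ι (ofSeq (fun n => a.seq (n - 1)) hb), ?_⟩
    rw [hW₂, hW₁, ← sub_eq_zero, ← map_sub, ← norm_eq_zero, ι.norm_map]
    apply norm_eq
    obtain ⟨N, hN⟩ := eventually_atTop.1 a.seq_spec
    refine eventually_atTop.2 ⟨N + 1, fun n hn => ?_⟩
    obtain ⟨m, rfl⟩ : ∃ m, n = m + 1 := ⟨n - 1, by omega⟩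
    rw [norm_eq_zero, sub_eq_add_neg, ← neg_one_smul ℂ a, seq_add, seq_smul, neg_one_smul,
      hN m (by omega), seq_twist, seq_twist, seq_ofSeq, map_smul, smul_smul, ← mul_pow, hε,
      one_pow, one_smul, Nat.add_sub_cancel, hV, add_neg_cancel]
  have hsurj : Function.Surjective fun x => W₁ (W₂ x) := by
    have hcl : IsClosed (Set.range fun x => W₁ (W₂ x)) :=
      (W₁.comp W₂).isometry.isClosedEmbedding.isClosed_range
    exact fun x => hι.induction_on (p := fun x => x ∈ Set.range fun x => W₁ (W₂ x)) x
      hcl fun a => hdense a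
  have hs1 : Function.Surjective W₁ := fun x => by
    obtain ⟨y, hy⟩ := hsurj x
    exact ⟨W₂ y, hy⟩
  have hs2 : Function.Surjective W₂ := fun x => by
    obtain ⟨y, hy⟩ := hsurj x
    exact ⟨ε • W₁ y, by rw [map_smul, ← hW]; exact hy⟩
  -- This is the statement that `orbit V` intertwines `S` with its twist.
  have hpow : ∀ S : X →ₗᵢ[ℂ] X, (∀ x, S (V x) = ε • V (S x)) →
      ∀ x n, ε ^ n • S ((V ^ n) x) = (V ^ n) (S x) := fun S hS x n => by
    induction n with
    | zero => simp
    | succ n ih =>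
      have e : ∀ y, (V ^ (n + 1)) y = V ((V ^ n) y) := fun y => by rw [pow_succ' V]; rfl
      rw [e, e, pow_succ' ε, hS, smul_smul, ← ih, map_smul, mul_right_comm, hε, one_mul]
  refine ⟨K, inferInstance, inferInstance, inferInstance, ι.comp (orbit V),
    LinearIsometryEquiv.ofSurjective W₁ hs1, LinearIsometryEquiv.ofSurjective W₂ hs2,
    fun x => ?_, fun x => ?_, hW⟩
  · change W₁ (ι (orbit V x)) = ι (orbit V (V₁ x))
    rw [hW₁]
    exact congrArg ι (seq_ext fun n => hpow V₁ h1 x n)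
  · change W₂ (ι (orbit V x)) = ι (orbit V (V₂ x))
    rw [hW₂]
    exact congrArg ι (seq_ext fun n => hpow V₂ h2 x n)

end UnitaryExtension

/-! ### Diagonal and permutation unitaries on square-summable families -/

section SequenceSpace

variable {ι : Type} {E : Type} [NormedAddCommGroup E]

theorem memℓp_two_of_hasSum {f : ι → E} {r : ℝ} (h : HasSum (fun i => ‖f i‖ ^ 2) r) :
    Memℓp f 2 :=
  memℓp_gen (by simpa using h.summable)

theorem lp_two_hasSum (f : lp (fun _ : ι => E) 2) : HasSum (fun i => ‖f i‖ ^ 2) (‖f‖ ^ 2) := by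
  simpa using lp.hasSum_norm (p := 2) (by simp) f

theorem lp_two_norm_sq {f : lp (fun _ : ι => E) 2} {r : ℝ}
    (h : HasSum (fun i => ‖f i‖ ^ 2) r) : ‖f‖ ^ 2 = r :=
  (lp_two_hasSum f).unique h

theorem hasSum_norm_comp_equiv (σ : ι ≃ ι) (f : lp (fun _ : ι => E) 2) :
    HasSum (fun i => ‖f (σ i)‖ ^ 2) (‖f‖ ^ 2) :=
  (σ.hasSum_iff (f := fun i => ‖f i‖ ^ 2)).2 (lp_two_hasSum f)

variable [InnerProductSpace ℂ E]

/-- The diagonal unitary on a space of square summable families. -/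
noncomputable def lpDiagonal (u : ι → E ≃ₗᵢ[ℂ] E) :
    lp (fun _ : ι => E) 2 ≃ₗᵢ[ℂ] lp (fun _ : ι => E) 2 where
  toFun f := ⟨fun i => u i (f i), memℓp_two_of_hasSum (by simpa using lp_two_hasSum f)⟩
  invFun f := ⟨fun i => (u i).symm (f i), memℓp_two_of_hasSum (by simpa using lp_two_hasSum f)⟩
  left_inv f := lp.ext (funext fun i => (u i).symm_apply_apply (f i))
  right_inv f := lp.ext (funext fun i => (u i).apply_symm_apply (f i))
  map_add' f g := lp.ext (funext fun i => map_add (u i) (f i) (g i))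
  map_smul' c f := lp.ext (funext fun i => map_smul (u i) c (f i))
  norm_map' f := by
    rw [← sq_eq_sq₀ (norm_nonneg _) (norm_nonneg _)]
    refine lp_two_norm_sq ?_
    change HasSum (fun i => ‖u i (f i)‖ ^ 2) (‖f‖ ^ 2)
    simpa using lp_two_hasSum f

@[simp] theorem lpDiagonal_apply (u : ι → E ≃ₗᵢ[ℂ] E) (f : lp (fun _ : ι => E) 2) (i : ι) :
    lpDiagonal u f i = u i (f i) := rfl

/-- The unitary that permutes the coordinates of square summable families. -/
noncomputable def lpReindex (σ : ι ≃ ι) :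
    lp (fun _ : ι => E) 2 ≃ₗᵢ[ℂ] lp (fun _ : ι => E) 2 where
  toFun f := ⟨fun i => f (σ i), memℓp_two_of_hasSum (hasSum_norm_comp_equiv σ f)⟩
  invFun f := ⟨fun i => f (σ.symm i), memℓp_two_of_hasSum (hasSum_norm_comp_equiv σ.symm f)⟩
  left_inv f := lp.ext (funext fun i => congrArg f (σ.apply_symm_apply i))
  right_inv f := lp.ext (funext fun i => congrArg f (σ.symm_apply_apply i))
  map_add' _ _ := rfl
  map_smul' _ _ := rfl
  norm_map' f := by
    rw [← sq_eq_sq₀ (norm_nonneg _) (norm_nonneg _)]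
    exact lp_two_norm_sq (hasSum_norm_comp_equiv σ f)

end SequenceSpace

/-! ### Building blocks of the isometric dilation -/

section IsometricDilation

theorem withLp_prod_norm_sq {H F : Type} [NormedAddCommGroup H] [NormedAddCommGroup F]
    (x : WithLp 2 (H × F)) : ‖x‖ ^ 2 = ‖x.fst‖ ^ 2 + ‖x.snd‖ ^ 2 :=
  WithLp.prod_norm_sq_eq_of_L2 x

theorem withLp_prod_ext {H F : Type} {x y : WithLp 2 (H × F)} (h₁ : x.fst = y.fst)
    (h₂ : x.snd = y.snd) : x = y :=
  WithLp.ofLp_injective _ (Prod.ext h₁ h₂)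

variable {H : Type} [NormedAddCommGroup H]

/-- The terms of the sequence `a, x₀, y₀, x₁, y₁, …` grouped in pairs. -/
def interlace (a : H) (f : ℕ → WithLp 2 (H × H)) : ℕ → WithLp 2 (H × H)
  | 0 => WithLp.toLp 2 (a, (f 0).fst)
  | n + 1 => WithLp.toLp 2 ((f n).snd, (f (n + 1)).fst)

/-- Interlacing inserts `a` and shifts the remaining entries by half a pair, so no norm is lost. -/
theorem hasSum_interlace {a : H} {f : ℕ → WithLp 2 (H × H)} {r : ℝ}
    (hf : HasSum (fun n => ‖f n‖ ^ 2) r) :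
    HasSum (fun n => ‖interlace a f n‖ ^ 2) (‖a‖ ^ 2 + r) := by
  simp only [withLp_prod_norm_sq] at hf ⊢
  have h1 : Summable fun n => ‖(f n).fst‖ ^ 2 :=
    hf.summable.of_nonneg_of_le (fun n => sq_nonneg _) fun n => by nlinarith [sq_nonneg ‖(f n).snd‖]
  have h2 : Summable fun n => ‖(f n).snd‖ ^ 2 :=
    hf.summable.of_nonneg_of_le (fun n => sq_nonneg _) fun n => by nlinarith [sq_nonneg ‖(f n).fst‖]
  have h3 : HasSum (fun n => ‖(interlace a f n).fst‖ ^ 2) (‖a‖ ^ 2 + ∑' n, ‖(f n).snd‖ ^ 2) := by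
    rw [← hasSum_nat_add_iff' 1]
    simpa [interlace] using h2.hasSum
  have h4 : ∀ n, (interlace a f n).snd = (f n).fst := fun n => by cases n <;> rfl
  simp only [h4]
  convert h3.add h1.hasSum using 1
  rw [hf.unique (h1.hasSum.add h2.hasSum)]
  ring

variable [InnerProductSpace ℂ H]

/-- The Hilbert space of the isometric dilation. -/
abbrev DilationSpace (H : Type) [NormedAddCommGroup H] [InnerProductSpace ℂ H] : Type :=
  WithLp 2 (H × lp (fun _ : ℕ => WithLp 2 (H × H)) 2)

/-- The isometry `(h, f) ↦ (A h, interlace (D h) f)`. -/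
noncomputable def interlaceIsometry (A D : H →L[ℂ] H) (h : ∀ x, ‖A x‖ ^ 2 + ‖D x‖ ^ 2 = ‖x‖ ^ 2) :
    DilationSpace H →ₗᵢ[ℂ] DilationSpace H where
  toFun x := WithLp.toLp 2 (A x.fst,
    ⟨interlace (D x.fst) x.snd, memℓp_two_of_hasSum (hasSum_interlace (lp_two_hasSum _))⟩)
  map_add' x y := by
    refine withLp_prod_ext (map_add A x.fst y.fst) (lp.ext (funext fun n => ?_))
    cases n with
    | zero => exact withLp_prod_ext (map_add D x.fst y.fst) rfl
    | succ n => rfl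
  map_smul' c x := by
    refine withLp_prod_ext (map_smul A c x.fst) (lp.ext (funext fun n => ?_))
    cases n with
    | zero => exact withLp_prod_ext (map_smul D c x.fst) rfl
    | succ n => rfl
  norm_map' x := by
    have h1 : ‖(⟨interlace (D x.fst) x.snd, memℓp_two_of_hasSum
      (hasSum_interlace (lp_two_hasSum _))⟩ : lp (fun _ : ℕ => WithLp 2 (H × H)) 2)‖ ^ 2 =
        ‖D x.fst‖ ^ 2 + ‖x.snd‖ ^ 2 := lp_two_norm_sq (hasSum_interlace (lp_two_hasSum x.snd))
    rw [← sq_eq_sq₀ (norm_nonneg _) (norm_nonneg _), withLp_prod_norm_sq x, ← h, add_assoc, ← h1]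
    exact withLp_prod_norm_sq _

@[simp] theorem interlaceIsometry_fst (A D : H →L[ℂ] H) (h) (x : DilationSpace H) :
    (interlaceIsometry A D h x).fst = A x.fst := rfl

@[simp] theorem interlaceIsometry_snd (A D : H →L[ℂ] H) (h) (x : DilationSpace H) (n : ℕ) :
    (interlaceIsometry A D h x).snd n = interlace (D x.fst) x.snd n := rfl

/-- A unitary on the second summand, extended by the identity. -/
noncomputable def sndUnitary {F : Type} [NormedAddCommGroup F] [InnerProductSpace ℂ F]
    (u : F ≃ₗᵢ[ℂ] F) : WithLp 2 (H × F) →ₗᵢ[ℂ] WithLp 2 (H × F) where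
  toFun x := WithLp.toLp 2 (x.fst, u x.snd)
  map_add' x y := withLp_prod_ext rfl (map_add u x.snd y.snd)
  map_smul' c x := withLp_prod_ext rfl (map_smul u c x.snd)
  norm_map' x := by
    rw [← sq_eq_sq₀ (norm_nonneg _) (norm_nonneg _), withLp_prod_norm_sq x, ← u.norm_map x.snd]
    exact withLp_prod_norm_sq _

@[simp] theorem sndUnitary_fst {F : Type} [NormedAddCommGroup F] [InnerProductSpace ℂ F]
    (u : F ≃ₗᵢ[ℂ] F) (x : WithLp 2 (H × F)) : (sndUnitary u x).fst = x.fst := rfl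

@[simp] theorem sndUnitary_snd {F : Type} [NormedAddCommGroup F] [InnerProductSpace ℂ F]
    (u : F ≃ₗᵢ[ℂ] F) (x : WithLp 2 (H × F)) : (sndUnitary u x).snd = u x.snd := rfl

/-- The unitary `(a, b) ↦ (a, ε b)`. -/
noncomputable def signSnd (ε : ℂ) (hε : ε * ε = 1) :
    WithLp 2 (H × H) ≃ₗᵢ[ℂ] WithLp 2 (H × H) where
  toFun x := WithLp.toLp 2 (x.fst, ε • x.snd)
  invFun x := WithLp.toLp 2 (x.fst, ε • x.snd)
  left_inv x := withLp_prod_ext rfl (show ε • ε • x.snd = _ by rw [smul_smul, hε, one_smul])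
  right_inv x := withLp_prod_ext rfl (show ε • ε • x.snd = _ by rw [smul_smul, hε, one_smul])
  map_add' x y := withLp_prod_ext rfl (smul_add ε x.snd y.snd)
  map_smul' c x := withLp_prod_ext rfl (smul_comm ε c x.snd)
  norm_map' x := by
    have : ‖ε‖ = 1 := by
      have := congrArg norm hε
      rw [norm_mul, norm_one] at this
      nlinarith [norm_nonneg ε]
    have h2 : ‖ε • x.snd‖ = ‖x.snd‖ := by rw [norm_smul, this, one_mul]
    rw [← sq_eq_sq₀ (norm_nonneg _) (norm_nonneg _), withLp_prod_norm_sq x, ← h2]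
    exact withLp_prod_norm_sq _

theorem signSnd_signSnd (ε : ℂ) (hε : ε * ε = 1) (x : WithLp 2 (H × H)) :
    signSnd ε hε (signSnd ε hε x) = x := (signSnd ε hε).left_inv x

end IsometricDilation

/-! ### Andô-type dilation of a pair of ε-commuting contractions -/

/-- In finite dimension, two linear maps with the same norms differ by a unitary. -/
theorem exists_unitary_comp_eq {H E : Type} [NormedAddCommGroup H] [InnerProductSpace ℂ H]
    [NormedAddCommGroup E] [InnerProductSpace ℂ E] [FiniteDimensional ℂ E]
    (L₁ L₂ : H →ₗ[ℂ] E) (h : ∀ x, ‖L₁ x‖ = ‖L₂ x‖) :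
    ∃ G : E ≃ₗᵢ[ℂ] E, ∀ x, G (L₁ x) = L₂ x := by
  obtain ⟨g, hg⟩ := L₁.rangeRestrict.exists_rightInverse_of_surjective L₁.range_rangeRestrict
  have hg' : ∀ s : LinearMap.range L₁, L₁ (g s) = s := fun s =>
    congrArg Subtype.val (LinearMap.congr_fun hg s)
  let φ : LinearMap.range L₁ →ₗᵢ[ℂ] E := ⟨L₂ ∘ₗ g, fun s => by
    rw [LinearMap.comp_apply, ← h, hg', Submodule.coe_norm]⟩
  refine ⟨φ.extend.toLinearIsometryEquiv rfl, fun x => ?_⟩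
  have h1 : φ.extend (L₁ x) = φ ⟨L₁ x, x, rfl⟩ := φ.extend_apply ⟨L₁ x, x, rfl⟩
  change φ.extend (L₁ x) = _
  rw [h1]
  change L₂ (g ⟨L₁ x, x, rfl⟩) = L₂ x
  -- The vectors `g (L₁ x)` and `x` differ by an element of the kernel of `L₁`, which is also the
  -- kernel of `L₂` since the norms agree.
  rw [← sub_eq_zero, ← map_sub, ← norm_eq_zero, ← h, map_sub, hg', sub_self, norm_zero]

/-- Positivity of `1 - A*A` yields a factorisation `D*D`, and any such `D` is a defect operator. -/
theorem exists_defect {H : Type} [NormedAddCommGroup H] [InnerProductSpace ℂ H] [CompleteSpace H]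
    (A : H →L[ℂ] H) (hA : ‖A‖ ≤ 1) : ∃ D : H →L[ℂ] H, ∀ x, ‖A x‖ ^ 2 + ‖D x‖ ^ 2 = ‖x‖ ^ 2 := by
  have h0 : 0 ≤ 1 - star A * A := by
    rw [sub_nonneg, ContinuousLinearMap.le_def]
    refine ⟨?_, fun x => ?_⟩
    · intro x y
      simp [ContinuousLinearMap.star_eq_adjoint, ContinuousLinearMap.adjoint_inner_left,
        ContinuousLinearMap.adjoint_inner_right, inner_sub_left, inner_sub_right]
    · have : ‖A x‖ ≤ ‖x‖ := (A.le_of_opNorm_le hA x).trans (by simp)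
      have h2 : ‖A x‖ ^ 2 ≤ ‖x‖ ^ 2 := by gcongr
      simp only [ContinuousLinearMap.reApplyInnerSelf_apply, sub_apply,
        one_apply_eq_self, mul_apply_eq_comp, inner_sub_left, map_sub,
        ContinuousLinearMap.star_eq_adjoint, ContinuousLinearMap.adjoint_inner_left]
      rw [inner_self_eq_norm_sq, inner_self_eq_norm_sq]
      linarith
  obtain ⟨D, hD⟩ := CStarAlgebra.nonneg_iff_eq_star_mul_self.1 h0
  refine ⟨D, fun x => ?_⟩
  have h1 := congrArg (fun T : H →L[ℂ] H => RCLike.re (inner ℂ (T x) x)) hD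
  simp only [sub_apply,
        one_apply_eq_self, mul_apply_eq_comp, inner_sub_left, map_sub,
        ContinuousLinearMap.star_eq_adjoint, ContinuousLinearMap.adjoint_inner_left] at h1
  rw [inner_self_eq_norm_sq, inner_self_eq_norm_sq, inner_self_eq_norm_sq] at h1
  linarith

/-- Two contractions on a finite-dimensional space that commute up to a sign have a dilation by
isometries that commute up to that sign. -/
theorem exists_isometric_dilation_pair {H : Type} [NormedAddCommGroup H] [InnerProductSpace ℂ H]
    [FiniteDimensional ℂ H] (A B : H →L[ℂ] H) (hA : ‖A‖ ≤ 1) (hB : ‖B‖ ≤ 1) (ε : ℂ)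
    (hε : ε * ε = 1) (hAB : A * B = ε • (B * A)) :
    ∃ V₁ V₂ : DilationSpace H →ₗᵢ[ℂ] DilationSpace H, (∀ x, V₁ (V₂ x) = ε • V₂ (V₁ x)) ∧
      (∀ x, (V₁ x).fst = A x.fst) ∧ ∀ x, (V₂ x).fst = B x.fst := by
  have : CompleteSpace H := FiniteDimensional.complete ℂ H
  have hAB' : ∀ x, A (B x) = ε • B (A x) := fun x => congrArg (fun T : H →L[ℂ] H => T x) hAB
  have hnorm : ‖ε‖ = 1 := by
    have := congrArg norm hε
    rw [norm_mul, norm_one] at this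
    nlinarith [norm_nonneg ε]
  obtain ⟨DA, hDA⟩ := exists_defect A hA
  obtain ⟨DB, hDB⟩ := exists_defect B hB
  -- `L₁` and `L₂` collect the defect entries that `V₁V₂` and `εV₂V₁` insert at position zero. Both
  -- have squared norm `‖x‖² - ‖ABx‖²`, so a unitary `G₀` carries one to the other.
  let L₁ : H →ₗ[ℂ] WithLp 2 (H × H) := (WithLp.linearEquiv 2 ℂ (H × H)).symm.toLinearMap ∘ₗ
    ((DA * B : H →L[ℂ] H).toLinearMap.prod DB.toLinearMap)
  let L₂ : H →ₗ[ℂ] WithLp 2 (H × H) := (WithLp.linearEquiv 2 ℂ (H × H)).symm.toLinearMap ∘ₗ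
    ((ε • (DB * A) : H →L[ℂ] H).toLinearMap.prod (ε • DA).toLinearMap)
  have hL : ∀ x, ‖L₁ x‖ = ‖L₂ x‖ := fun x => by
    rw [← sq_eq_sq₀ (norm_nonneg _) (norm_nonneg _), withLp_prod_norm_sq, withLp_prod_norm_sq]
    change ‖DA (B x)‖ ^ 2 + ‖DB x‖ ^ 2 = ‖ε • DB (A x)‖ ^ 2 + ‖ε • DA x‖ ^ 2
    have h1 := hDA (B x)
    rw [hAB', norm_smul, hnorm, one_mul] at h1
    rw [norm_smul, norm_smul, hnorm, one_mul, one_mul]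
    linarith [hDA x, hDB x, hDB (A x)]
  obtain ⟨G₀, hG₀⟩ := exists_unitary_comp_eq L₁ L₂ hL
  let σ : WithLp 2 (H × H) ≃ₗᵢ[ℂ] WithLp 2 (H × H) := signSnd ε hε
  let G : ℕ → WithLp 2 (H × H) ≃ₗᵢ[ℂ] WithLp 2 (H × H) :=
    -- Beyond position zero, commutation up to `ε` demands `G (n + 1) σ (G n)⁻¹ = σ`, which forces
    -- this recursion. For `ε = 1` it gives a constant sequence, as in Andô's proof.
    fun n => Nat.rec G₀ (fun _ g => σ.trans (g.trans σ)) n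
  have hG : ∀ n x, G (n + 1) x = σ (G n (σ x)) := fun n x => rfl
  have hs : ∀ (y : DilationSpace H) (n : ℕ), (ε • y).snd n = ε • y.snd n := fun y n => by
    rw [WithLp.smul_snd]; rfl
  -- The diagonal unitary follows the half-shift in `V₁`, and its inverse precedes the half-shift in
  -- `V₂`. Thus it cancels in `V₂V₁`, while in `V₁V₂` it corrects the full shift.
  refine ⟨(sndUnitary (lpDiagonal G)).comp (interlaceIsometry A DA hDA),
    (interlaceIsometry B DB hDB).comp (sndUnitary (lpDiagonal fun n => (G n).symm.trans σ)),
    fun x => withLp_prod_ext (hAB' x.fst) (lp.ext (funext fun n => ?_)), fun x => rfl, fun x => rfl⟩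
  rw [hs]
  simp only [LinearIsometry.coe_comp, Function.comp_apply, sndUnitary_snd, lpDiagonal_apply,
    interlaceIsometry_snd, interlaceIsometry_fst, sndUnitary_fst]
  cases n with
  | zero =>
    refine (hG₀ x.fst).trans ?_
    simp only [interlace, lpDiagonal_apply, interlaceIsometry_snd, LinearIsometryEquiv.trans_apply,
      LinearIsometryEquiv.symm_apply_apply]
    rfl
  | succ n =>
    have h1 : (interlace (DA x.fst) x.snd n).snd = (x.snd n).fst := by cases n <;> rfl
    simp only [interlace, interlaceIsometry_snd, lpDiagonal_apply, sndUnitary_snd,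
      LinearIsometryEquiv.trans_apply, LinearIsometryEquiv.symm_apply_apply]
    refine (?_ : _ = σ (x.snd n)).trans (withLp_prod_ext ?_ rfl)
    · refine Eq.trans ?_ (congrArg σ ((G n).apply_symm_apply (x.snd n)))
      rw [hG]
      refine congrArg (fun z => σ (G n z)) ?_
      refine Eq.trans ?_ (signSnd_signSnd ε hε ((G n).symm (x.snd n)))
      refine congrArg σ (withLp_prod_ext ?_ rfl)
      cases n <;> rfl
    · change (x.snd n).fst = ε • ε • (interlace (DA x.fst) x.snd n).snd
      rw [smul_smul, hε, one_smul, h1]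

/-- Two contractions on a finite-dimensional space that commute up to a sign have a dilation by
unitaries that commute up to that sign. -/
theorem exists_unitary_dilation_pair {H : Type} [NormedAddCommGroup H] [InnerProductSpace ℂ H]
    [FiniteDimensional ℂ H] (A B : H →L[ℂ] H) (hA : ‖A‖ ≤ 1) (hB : ‖B‖ ≤ 1) (ε : ℂ)
    (hε : ε * ε = 1) (hAB : A * B = ε • (B * A)) :
    ∃ (K : Type) (_ : NormedAddCommGroup K) (_ : InnerProductSpace ℂ K) (_ : CompleteSpace K)
      (J : H →ₗᵢ[ℂ] K) (U₁ U₂ : K ≃ₗᵢ[ℂ] K), (∀ x, U₁ (U₂ x) = ε • U₂ (U₁ x)) ∧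
      ∀ m n h h', inner ℂ (J h') ((U₁ ^ m) ((U₂ ^ n) (J h))) = inner ℂ h' ((A ^ m) ((B ^ n) h)) := by
  obtain ⟨V₁, V₂, hV, h1, h2⟩ := exists_isometric_dilation_pair A B hA hB ε hε hAB
  obtain ⟨K, _, _, _, J, U₁, U₂, hJ1, hJ2, hU⟩ := exists_unitary_extension V₁ V₂ ε hε hV
  let J₀ : H →ₗᵢ[ℂ] DilationSpace H :=
    { toFun := fun h => WithLp.toLp 2 (h, 0)
      map_add' := fun x y => withLp_prod_ext rfl (add_zero _).symm
      map_smul' := fun c x => withLp_prod_ext rfl (smul_zero _).symm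
      norm_map' := fun x => by
        rw [← sq_eq_sq₀ (norm_nonneg _) (norm_nonneg _)]
        refine (withLp_prod_norm_sq _).trans ?_
        change ‖x‖ ^ 2 + ‖(0 : lp (fun _ : ℕ => WithLp 2 (H × H)) 2)‖ ^ 2 = _
        simp }
  -- The first coordinate of `V x` depends only on that of `x`, so powers compress to powers.
  have hpow : ∀ (U : K ≃ₗᵢ[ℂ] K) (V : DilationSpace H →ₗᵢ[ℂ] DilationSpace H) (C : H →L[ℂ] H),
      (∀ x, U (J x) = J (V x)) → (∀ x, (V x).fst = C x.fst) →
      ∀ (n : ℕ) x, ∃ y, (U ^ n) (J x) = J y ∧ y.fst = (C ^ n) x.fst := by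
    intro U V C h3 h4 n x
    induction n with
    | zero => exact ⟨x, rfl, rfl⟩
    | succ n ih =>
      obtain ⟨y, hy1, hy2⟩ := ih
      refine ⟨V y, ?_, ?_⟩
      · rw [pow_succ', ← h3, ← hy1]; rfl
      · rw [pow_succ', h4, hy2]; rfl
  refine ⟨K, inferInstance, inferInstance, inferInstance, J.comp J₀, U₁, U₂, hU, fun m n h h' => ?_⟩
  obtain ⟨y, hy1, hy2⟩ := hpow U₂ V₂ B hJ2 h2 n (J₀ h)
  obtain ⟨z, hz1, hz2⟩ := hpow U₁ V₁ A hJ1 h1 m y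
  change inner ℂ (J (J₀ h')) ((U₁ ^ m) ((U₂ ^ n) (J (J₀ h)))) = _
  rw [hy1, hz1, J.inner_map_map, WithLp.prod_inner_apply]
  change inner ℂ h' z.fst + inner ℂ (0 : lp (fun _ : ℕ => WithLp 2 (H × H)) 2) z.snd = _
  rw [inner_zero_left, add_zero, hz2, hy2]
  rfl

/-! ### Unitary dilation of a scalar contraction -/

section ScalarDilation

variable {K : Type} [NormedAddCommGroup K] [InnerProductSpace ℂ K]

/-- Multiplication by a scalar of modulus one. -/
noncomputable def scalarUnitary (K : Type) [NormedAddCommGroup K] [InnerProductSpace ℂ K] (c : ℂ)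
    (hc : ‖c‖ = 1) : K ≃ₗᵢ[ℂ] K where
  __ := LinearEquiv.smulOfNeZero ℂ K c (norm_ne_zero_iff.1 (by rw [hc]; exact one_ne_zero))
  norm_map' x := by
    change ‖c • x‖ = ‖x‖
    rw [norm_smul, hc, one_mul]

theorem scalarUnitary_pow_apply (c : ℂ) (hc : ‖c‖ = 1) (m : ℕ) (x : K) :
    (scalarUnitary K c hc ^ m) x = c ^ m • x := by
  induction m with
  | zero => simp
  | succ m ih =>
    rw [pow_succ', pow_succ', ← smul_smul, ← ih]
    rfl

theorem hasSum_geometric_smul (c : ℂ) (hc : ‖c‖ < 1) (h : K) :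
    HasSum (fun n : ℤ => ‖if 0 ≤ n then ((√(1 - ‖c‖ ^ 2) : ℝ) * c ^ n.toNat : ℂ) • h else 0‖ ^ 2)
      (‖h‖ ^ 2) := by
  have h1 : ‖c‖ ^ 2 < 1 := by nlinarith [norm_nonneg c]
  rw [← Function.Injective.hasSum_iff (Nat.cast_injective (R := ℤ))]
  · have h2 := ((hasSum_geometric_of_lt_one (sq_nonneg ‖c‖) h1).mul_left (1 - ‖c‖ ^ 2)).mul_right
      (‖h‖ ^ 2)
    rw [mul_inv_cancel₀ (by linarith), one_mul] at h2
    have h3 : 0 ≤ 1 - ‖c‖ ^ 2 := by linarith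
    refine (congrArg (HasSum · _) (funext fun n => ?_)).mp h2
    simp [norm_smul, mul_pow, Real.sq_sqrt h3, ← pow_mul, mul_comm]
  · intro n hn
    have : ¬ 0 ≤ n := fun h0 => hn ⟨n.toNat, Int.toNat_of_nonneg h0⟩
    simp [this]

/-- The vector `(√(1 - |c|²) cⁿ h)` supported on the natural numbers. -/
noncomputable def geometricIsometry (K : Type) [NormedAddCommGroup K] [InnerProductSpace ℂ K]
    (c : ℂ) (hc : ‖c‖ < 1) : K →ₗᵢ[ℂ] lp (fun _ : ℤ => K) 2 where
  toFun h := ⟨fun n => if 0 ≤ n then ((√(1 - ‖c‖ ^ 2) : ℝ) * c ^ n.toNat : ℂ) • h else 0,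
    memℓp_two_of_hasSum (hasSum_geometric_smul c hc h)⟩
  map_add' x y := lp.ext (funext fun n => by
    rw [lp.coeFn_add, Pi.add_apply]
    dsimp only
    split_ifs <;> simp)
  map_smul' a x := lp.ext (funext fun n => by
    rw [lp.coeFn_smul, Pi.smul_apply]
    dsimp only [RingHom.id_apply]
    split_ifs
    · rw [smul_comm]
    · simp)
  norm_map' h := by
    rw [← sq_eq_sq₀ (norm_nonneg _) (norm_nonneg _)]
    exact lp_two_norm_sq (hasSum_geometric_smul c hc h)

theorem geometricIsometry_apply (c : ℂ) (hc : ‖c‖ < 1) (h : K) (n : ℤ) :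
    geometricIsometry K c hc h n =
      if 0 ≤ n then ((√(1 - ‖c‖ ^ 2) : ℝ) * c ^ n.toNat : ℂ) • h else 0 := rfl

theorem lpReindex_addRight_pow_apply (f : lp (fun _ : ℤ => K) 2) (m : ℕ) (n : ℤ) :
    (lpReindex (Equiv.addRight (1 : ℤ)) ^ m) f n = f (n + m) := by
  induction m generalizing n with
  | zero => simp
  | succ m ih =>
    rw [pow_succ']
    refine (ih (n + 1)).trans ?_
    push_cast
    rw [add_assoc, add_comm (1 : ℤ)]

/-- The diagonal unitaries with constant entries. -/
noncomputable def lpConst (ι K : Type) [NormedAddCommGroup K] [InnerProductSpace ℂ K] :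
    (K ≃ₗᵢ[ℂ] K) →* (lp (fun _ : ι => K) 2 ≃ₗᵢ[ℂ] lp (fun _ : ι => K) 2) where
  toFun W := lpDiagonal fun _ => W
  map_one' := by ext; rfl
  map_mul' _ _ := by ext; rfl

@[simp] theorem lpConst_apply {ι : Type} (W : K ≃ₗᵢ[ℂ] K) (f : lp (fun _ : ι => K) 2) (i : ι) :
    lpConst ι K W f i = W (f i) := rfl

/-- A scalar contraction has a unitary dilation that commutes with a given family of unitaries. -/
theorem exists_scalar_dilation (K : Type) [NormedAddCommGroup K] [InnerProductSpace ℂ K]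
    [CompleteSpace K] (c : ℂ) (hc : ‖c‖ ≤ 1) :
    ∃ (K' : Type) (_ : NormedAddCommGroup K') (_ : InnerProductSpace ℂ K') (_ : CompleteSpace K')
      (D : (K ≃ₗᵢ[ℂ] K) →* (K' ≃ₗᵢ[ℂ] K')) (w : K' ≃ₗᵢ[ℂ] K') (J : K →ₗᵢ[ℂ] K'),
      (∀ W, Commute w (D W)) ∧
      (∀ (W W' : K ≃ₗᵢ[ℂ] K) (q : ℂ), (∀ x, W (W' x) = q • W' (W x)) →
        ∀ x, D W (D W' x) = q • D W' (D W x)) ∧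
      ∀ (m : ℕ) W h h', inner ℂ (J h') ((w ^ m) (D W (J h))) = c ^ m * inner ℂ h' (W h) := by
  -- For `|c| < 1` the shift multiplies the geometric vector by `c` at every index `n ≥ 0`; for `|c|
  -- = 1` the scalar is already unitary.
  rcases hc.lt_or_eq with hc | hc
  · refine ⟨lp (fun _ : ℤ => K) 2, inferInstance, inferInstance, inferInstance, lpConst ℤ K,
      lpReindex (Equiv.addRight (1 : ℤ)), geometricIsometry K c hc, fun W => ?_, fun W W' q h x => ?_,
      fun m W h h' => ?_⟩
    · ext; rfl
    · exact lp.ext (funext fun n => h (x n))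
    · rw [← LinearIsometry.inner_map_map (geometricIsometry K c hc), ← inner_smul_right,
        lp.inner_eq_tsum, lp.inner_eq_tsum]
      refine tsum_congr fun n => ?_
      rw [lpReindex_addRight_pow_apply, lpConst_apply, lp.coeFn_smul, Pi.smul_apply,
        geometricIsometry_apply, geometricIsometry_apply, geometricIsometry_apply]
      -- At negative indices the shifted vector may be non-zero, but `J h'` vanishes there.
      by_cases hn : 0 ≤ n
      · rw [if_pos hn, if_pos hn, if_pos (by omega), map_smul, smul_smul,
          Int.toNat_add hn (by omega), Int.toNat_natCast, pow_add]
        ring_nf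
      · rw [if_neg hn, inner_zero_left, inner_zero_left]
  · refine ⟨K, inferInstance, inferInstance, inferInstance, MonoidHom.id _, scalarUnitary K c hc,
      LinearIsometry.id, fun W => ?_, fun W W' q h x => h x, fun m W h h' => ?_⟩
    · ext x; exact (map_smul W c x).symm
    · rw [scalarUnitary_pow_apply, inner_smul_right]; rfl

end ScalarDilation

theorem prod_ofFn_pow_mul {R : Type} [Monoid R] {k : ℕ} (f : Fin k → R) (w : R)
    (hw : ∀ j, Commute w (f j)) (e : Fin k → ℕ) :
    (List.ofFn fun j => w ^ e j * f j).prod = w ^ (∑ j, e j) * (List.ofFn f).prod := by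
  induction k with
  | zero => simp
  | succ k ih =>
    rw [List.ofFn_succ, List.ofFn_succ, List.prod_cons, List.prod_cons,
      ih (fun j => f j.succ) (fun j => hw j.succ) fun j => e j.succ, Fin.sum_univ_succ, pow_add,
      mul_assoc, mul_assoc, ← mul_assoc (f 0), ← ((hw 0).pow_left _).eq, mul_assoc]

/-- Serves both for scalar multiples of one entry and for the shift that dilates the scalar. -/
theorem prod_ofFn_update_mul {R : Type} [Monoid R] {k : ℕ} (f : Fin k → R) (w : R)
    (hw : ∀ j, Commute w (f j)) (i : Fin k) (m : Fin k → ℕ) :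
    (List.ofFn fun j => Function.update f i (w * f i) j ^ m j).prod =
      w ^ m i * (List.ofFn fun j => f j ^ m j).prod := by
  have h := prod_ofFn_pow_mul (fun j => f j ^ m j) w (fun j => (hw j).pow_right _)
    (Pi.single i (m i))
  rw [Finset.sum_pi_single' i (m i), if_pos (Finset.mem_univ i)] at h
  rw [← h]
  congr 2
  funext j
  rcases eq_or_ne j i with rfl | hj
  · simp [(hw j).mul_pow]
  · simp [hj]

/-! ### Scaling the entries of a dilated tuple -/

section UnitarilyDilated

variable {k : ℕ} {H : Type} [NormedAddCommGroup H] [InnerProductSpace ℂ H]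

/-- The tuple `T` is dilated by unitaries that are `q`-commuting. -/
def UnitarilyDilated (q : Fin k → Fin k → ℂ) (T : Fin k → H →L[ℂ] H) : Prop :=
  ∃ (K : Type) (_ : NormedAddCommGroup K) (_ : InnerProductSpace ℂ K) (_ : CompleteSpace K)
    (U : Fin k → K ≃ₗᵢ[ℂ] K) (J : H →ₗᵢ[ℂ] K),
    (∀ i j, i < j → ∀ x, U i (U j x) = q i j • U j (U i x)) ∧
    ∀ m h h', inner ℂ (J h') ((List.ofFn fun i => U i ^ m i).prod (J h)) =
      inner ℂ h' (orderedMonomial T m h)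

theorem orderedMonomial_update_smul (T : Fin k → H →L[ℂ] H) (i : Fin k) (c : ℂ) (m : Fin k → ℕ) :
    orderedMonomial (Function.update T i (c • T i)) m = c ^ m i • orderedMonomial T m := by
  have h := prod_ofFn_update_mul T (c • 1) (fun j => (Commute.one_left (T j)).smul_left c) i m
  rw [smul_mul_assoc, one_mul, smul_pow, one_pow, smul_mul_assoc, one_mul] at h
  exact h

/-- The unitary `w` that dilates `c` commutes with all the others, so multiplying one entry by it
leaves `q` unchanged and contributes `c ^ m i` to each compressed monomial. -/
theorem UnitarilyDilated.update_smul {q : Fin k → Fin k → ℂ} {T : Fin k → H →L[ℂ] H}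
    (hT : UnitarilyDilated q T) (i : Fin k) (c : ℂ) (hc : ‖c‖ ≤ 1) :
    UnitarilyDilated q (Function.update T i (c • T i)) := by
  obtain ⟨K, _, _, _, U, J, hU, hJ⟩ := hT
  obtain ⟨K', _, _, _, D, w, J', hw, hD, hJ'⟩ := exists_scalar_dilation K c hc
  refine ⟨K', inferInstance, inferInstance, inferInstance,
    Function.update (fun j => D (U j)) i (w * D (U i)), J'.comp J, fun a b hab x => ?_,
    fun m h h' => ?_⟩
  · have hcomm : ∀ W x, w (D W x) = D W (w x) := fun W x =>
      congrArg (fun f : K' ≃ₗᵢ[ℂ] K' => f x) (hw W).eq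
    have h1 := hD (U a) (U b) (q a b) (hU a b hab)
    rcases eq_or_ne a i with rfl | ha
    · rw [Function.update_self, Function.update_of_ne hab.ne']
      change w (D (U a) (D (U b) x)) = q a b • D (U b) (w (D (U a) x))
      rw [h1, map_smul, hcomm (U b)]
    · rcases eq_or_ne b i with rfl | hb
      · rw [Function.update_self, Function.update_of_ne ha]
        change D (U a) (w (D (U b) x)) = q a b • w (D (U b) (D (U a) x))
        rw [← hcomm, h1, map_smul]
      · rw [Function.update_of_ne ha, Function.update_of_ne hb]
        exact h1 x
  · have h1 := prod_ofFn_update_mul (fun j => D (U j)) w (fun j => hw (U j)) i m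
    have h2 : (List.ofFn fun j => D (U j) ^ m j).prod = D (List.ofFn fun j => U j ^ m j).prod := by
      rw [map_list_prod, List.map_ofFn]
      simp [Function.comp_def]
    rw [h1, h2, orderedMonomial_update_smul]
    refine (hJ' (m i) _ (J h) (J h')).trans ?_
    rw [hJ, smul_apply, inner_smul_right]

theorem UnitarilyDilated.smul {q : Fin k → Fin k → ℂ} {T : Fin k → H →L[ℂ] H}
    (hT : UnitarilyDilated q T) (c : Fin k → ℂ) (hc : ∀ i, ‖c i‖ ≤ 1) :
    UnitarilyDilated q fun i => c i • T i := by
  have h : ∀ S : Finset (Fin k), UnitarilyDilated q fun i => if i ∈ S then c i • T i else T i := by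
    intro S
    induction S using Finset.induction_on with
    | empty => simpa using hT
    | insert a S ha ih =>
      convert ih.update_smul a (c a) (hc a) using 1
      funext i
      rcases eq_or_ne i a with rfl | hi
      · simp [ha]
      · simp [hi]
  simpa using h Finset.univ

/-- A unitary as a bounded operator. -/
noncomputable def unitaryOperator (K : Type) [NormedAddCommGroup K] [InnerProductSpace ℂ K]
    [CompleteSpace K] : (K ≃ₗᵢ[ℂ] K) →* (K →L[ℂ] K) :=
  (unitary (K →L[ℂ] K)).subtype.comp Unitary.linearIsometryEquiv.symm.toMonoidHom

theorem unitaryOperator_apply {K : Type} [NormedAddCommGroup K] [InnerProductSpace ℂ K]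
    [CompleteSpace K] (W : K ≃ₗᵢ[ℂ] K) (x : K) : unitaryOperator K W x = W x := rfl

theorem unitaryOperator_mem {K : Type} [NormedAddCommGroup K] [InnerProductSpace ℂ K]
    [CompleteSpace K] (W : K ≃ₗᵢ[ℂ] K) : unitaryOperator K W ∈ unitary (K →L[ℂ] K) :=
  (Unitary.linearIsometryEquiv.symm W).2

theorem unitaryOperator_prod {K : Type} [NormedAddCommGroup K] [InnerProductSpace ℂ K]
    [CompleteSpace K] (U : Fin k → K ≃ₗᵢ[ℂ] K) (m : Fin k → ℕ) :
    orderedMonomial (fun i => unitaryOperator K (U i)) m =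
      unitaryOperator K (List.ofFn fun i => U i ^ m i).prod := by
  rw [orderedMonomial, map_list_prod, List.map_ofFn]
  simp [Function.comp_def]

theorem UnitarilyDilated.exists_dilates [CompleteSpace H] {q : Fin k → Fin k → ℂ}
    {T : Fin k → H →L[ℂ] H} (hT : UnitarilyDilated q T) :
    ∃ (K : Type) (_ : NormedAddCommGroup K) (_ : InnerProductSpace ℂ K) (_ : CompleteSpace K)
      (U : Fin k → K →L[ℂ] K), (∀ j, U j ∈ unitary (K →L[ℂ] K)) ∧
      (∀ i j, i < j → U i * U j = q i j • (U j * U i)) ∧ Dilates U T := by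
  obtain ⟨K, _, _, _, U, J, hU, hJ⟩ := hT
  refine ⟨K, inferInstance, inferInstance, inferInstance, fun i => unitaryOperator K (U i),
    fun j => unitaryOperator_mem _, fun i j hij => ContinuousLinearMap.ext (hU i j hij), J,
    fun m => ?_⟩
  ext1 h
  refine ext_inner_left ℂ fun h' => ?_
  rw [ContinuousLinearMap.comp_apply, ContinuousLinearMap.adjoint_inner_right,
    unitaryOperator_prod]
  exact (hJ m h h').symm

/-- Here the dilating entry is scaled too, so `c` needs no bound; this reinstates `β` in part (0).
-/
theorem Dilates.update_smul [CompleteSpace H] {K : Type} [NormedAddCommGroup K]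
    [InnerProductSpace ℂ K] [CompleteSpace K] {N : Fin k → K →L[ℂ] K} {T : Fin k → H →L[ℂ] H}
    (h : Dilates N T) (i : Fin k) (c : ℂ) :
    Dilates (Function.update N i (c • N i)) (Function.update T i (c • T i)) := by
  obtain ⟨V, hV⟩ := h
  refine ⟨V, fun m => ?_⟩
  rw [orderedMonomial_update_smul, orderedMonomial_update_smul, hV m,
    ContinuousLinearMap.smul_comp, ContinuousLinearMap.comp_smul]

end UnitarilyDilated

/-! ### Words in two ε-commuting variables -/

section Words

/-- The words `a`, `b` and `ab`. -/
inductive Letter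
  | a
  | b
  | ab

/-- The value of a word. -/
def Letter.eval {R : Type} [Mul R] (x y : R) : Letter → R
  | .a => x
  | .b => y
  | .ab => x * y

/-- The sign with which two words in `ε`-commuting variables commute. -/
def Letter.sign (ε : ℂ) : Letter → Letter → ℂ
  | .a, .a => 1
  | .b, .b => 1
  | .ab, .ab => 1
  | _, _ => ε

theorem pow_mul_pow_swap {R : Type} [Ring R] [Algebra ℂ R] {x y : R} {ε : ℂ}
    (h : y * x = ε • (x * y)) (r p : ℕ) : y ^ r * x ^ p = ε ^ (r * p) • (x ^ p * y ^ r) := by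
  have h1 : ∀ p : ℕ, y * x ^ p = ε ^ p • (x ^ p * y) := fun p => by
    induction p with
    | zero => simp
    | succ p ih =>
      rw [pow_succ, ← mul_assoc, ih, smul_mul_assoc, mul_assoc, h, mul_smul_comm, smul_smul,
        mul_assoc, pow_succ]
  induction r with
  | zero => simp
  | succ r ih =>
    rw [pow_succ', mul_assoc, ih, mul_smul_comm, ← mul_assoc, h1, smul_mul_assoc, smul_smul,
      mul_assoc, Nat.succ_mul, pow_add]

/-- A noncommutative monomial in two variables that has a normal form when they `ε`-commute. -/
def HasNormalForm (ε : ℂ) (F : ∀ (R : Type) [Ring R], R → R → R) : Prop :=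
  ∃ (σ : ℂ) (p r : ℕ), ∀ (R : Type) [Ring R] [Algebra ℂ R] (x y : R), y * x = ε • (x * y) →
    F R x y = σ • (x ^ p * y ^ r)

theorem HasNormalForm.one {ε : ℂ} : HasNormalForm ε fun _ _ _ _ => 1 :=
  ⟨1, 0, 0, fun R _ _ x y _ => by simp⟩

theorem HasNormalForm.mul {ε : ℂ} {F G : ∀ (R : Type) [Ring R], R → R → R}
    (hF : HasNormalForm ε F) (hG : HasNormalForm ε G) :
    HasNormalForm ε fun R _ x y => F R x y * G R x y := by
  obtain ⟨σ, p, r, h⟩ := hF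
  obtain ⟨σ', p', r', h'⟩ := hG
  refine ⟨σ * σ' * ε ^ (r * p'), p + p', r + r', fun R _ _ x y hxy => ?_⟩
  change F R x y * G R x y = _
  rw [h R x y hxy, h' R x y hxy, smul_mul_assoc, mul_smul_comm, smul_smul, mul_assoc,
    ← mul_assoc (y ^ r), pow_mul_pow_swap hxy, smul_mul_assoc, mul_smul_comm, smul_smul, pow_add,
    pow_add]
  simp only [mul_assoc]

theorem HasNormalForm.pow {ε : ℂ} {F : ∀ (R : Type) [Ring R], R → R → R}
    (hF : HasNormalForm ε F) (n : ℕ) : HasNormalForm ε fun R _ x y => F R x y ^ n := by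
  induction n with
  | zero => simpa using HasNormalForm.one
  | succ n ih => simpa only [pow_succ] using ih.mul hF

theorem HasNormalForm.letter (ε : ℂ) (s : Letter) :
    HasNormalForm ε fun _ _ x y => s.eval x y := by
  cases s
  · exact ⟨1, 1, 0, fun R _ _ x y _ => by simp [Letter.eval]⟩
  · exact ⟨1, 0, 1, fun R _ _ x y _ => by simp [Letter.eval]⟩
  · exact ⟨1, 1, 1, fun R _ _ x y _ => by simp [Letter.eval]⟩

theorem HasNormalForm.prod_ofFn (ε : ℂ) {k : ℕ} (s : Fin k → Letter) (m : Fin k → ℕ) :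
    HasNormalForm ε fun _ _ x y => (List.ofFn fun i => (s i).eval x y ^ m i).prod := by
  induction k with
  | zero => simpa using HasNormalForm.one
  | succ k ih =>
    simpa only [List.ofFn_succ, List.prod_cons] using
      ((HasNormalForm.letter ε (s 0)).pow (m 0)).mul (ih (fun i => s i.succ) fun i => m i.succ)

theorem Letter.eval_mul_eval {R : Type} [Ring R] [Algebra ℂ R] {x y : R} {ε : ℂ} (hε : ε * ε = 1)
    (h : x * y = ε • (y * x)) (s t : Letter) :
    s.eval x y * t.eval x y = sign ε s t • (t.eval x y * s.eval x y) := by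
  have h' : y * x = ε • (x * y) := by rw [h, smul_smul, hε, one_smul]
  have h1 : x * (x * y) = ε • (x * y * x) := by
    rw [mul_assoc, h', mul_smul_comm, smul_smul, hε, one_smul]
  have h2 : x * y * y = ε • (y * (x * y)) := by
    rw [← mul_assoc, h', smul_mul_assoc, smul_smul, hε, one_smul]
  cases s <;> cases t
  · exact (one_smul ℂ _).symm
  · exact h
  · exact h1
  · exact h'
  · exact (one_smul ℂ _).symm
  · change y * (x * y) = ε • (x * y * y)
    rw [h2, smul_smul, hε, one_smul]
  · change x * y * x = ε • (x * (x * y))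
    rw [h1, smul_smul, hε, one_smul]
  · exact h2
  · exact (one_smul ℂ _).symm

theorem Letter.map_eval {R S : Type} [Monoid R] [Monoid S] (φ : R →* S) (x y : R) (s : Letter) :
    φ (s.eval x y) = s.eval (φ x) (φ y) := by
  cases s <;> simp [eval]

/-- Words in two contractions that commute up to a sign are dilated by unitaries. -/
theorem unitarilyDilated_eval {H : Type} [NormedAddCommGroup H] [InnerProductSpace ℂ H]
    [FiniteDimensional ℂ H] (A B : H →L[ℂ] H) (hA : ‖A‖ ≤ 1) (hB : ‖B‖ ≤ 1) (ε : ℂ)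
    (hε : ε * ε = 1) (hAB : A * B = ε • (B * A)) {k : ℕ} (s : Fin k → Letter) :
    UnitarilyDilated (fun i j => Letter.sign ε (s i) (s j)) fun i => (s i).eval A B := by
  obtain ⟨K, _, _, _, J, U₁, U₂, hU, hJ⟩ := exists_unitary_dilation_pair A B hA hB ε hε hAB
  have hU' : unitaryOperator K U₁ * unitaryOperator K U₂ =
      ε • (unitaryOperator K U₂ * unitaryOperator K U₁) := ContinuousLinearMap.ext hU
  have hflip : ∀ {R : Type} [Ring R] [Algebra ℂ R] {x y : R}, x * y = ε • (y * x) →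
      y * x = ε • (x * y) := fun {R} _ _ x y h => by rw [h, smul_smul, hε, one_smul]
  refine ⟨K, inferInstance, inferInstance, inferInstance, fun i => (s i).eval U₁ U₂, J,
    fun i j _ x => ?_, fun m h h' => ?_⟩
  · have h1 := congrArg (fun f : K →L[ℂ] K => f x) (Letter.eval_mul_eval hε hU' (s i) (s j))
    rw [← Letter.map_eval, ← Letter.map_eval] at h1
    exact h1
  -- The normal form is uniform over all algebras: the same `σ`, `p`, `r` serve upstairs and
  -- downstairs, leaving only the monomial `aᵖ bʳ` to compare.
  · obtain ⟨σ, p, r, hn⟩ := HasNormalForm.prod_ofFn ε s m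
    have h1 : (List.ofFn fun i => (s i).eval (unitaryOperator K U₁) (unitaryOperator K U₂) ^ m i).prod
      = _ := hn (K →L[ℂ] K) _ _ (hflip hU')
    have h2 : (List.ofFn fun i => (s i).eval A B ^ m i).prod = _ := hn (H →L[ℂ] H) A B (hflip hAB)
    have h3 := unitaryOperator_prod (fun i => (s i).eval U₁ U₂) m
    rw [orderedMonomial] at h3 ⊢
    simp only [Letter.map_eval] at h3
    rw [h1] at h3
    rw [h2, ← unitaryOperator_apply, ← h3, smul_apply,
      smul_apply, inner_smul_right, inner_smul_right, ← map_pow, ← map_pow]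
    exact congrArg (σ * ·) (hJ p r h h')

end Words

/-! ### Anti-commuting operators on the plane -/

section PlaneOperators

/-- The complex Euclidean plane. -/
abbrev Plane : Type := EuclideanSpace ℂ (Fin 2)

theorem Plane.exists_eq_add {u w : Plane} (h : ∀ s t : ℂ, s • u + t • w = 0 → s = 0 ∧ t = 0)
    (x : Plane) : ∃ a b : ℂ, x = a • u + b • w := by
  have hli : LinearIndependent ℂ ![u, w] := LinearIndependent.pair_iff.2 h
  have htop := hli.span_eq_top_of_card_eq_finrank (by simp)
  have hx : x ∈ Submodule.span ℂ (Set.range ![u, w]) := htop ▸ Submodule.mem_top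
  rw [Matrix.range_cons, Matrix.range_cons, Matrix.range_empty, Set.union_empty,
    Set.singleton_union, Submodule.mem_span_pair] at hx
  obtain ⟨a, b, hab⟩ := hx
  exact ⟨a, b, hab.symm⟩

theorem Plane.clm_ext {u w : Plane} (h : ∀ s t : ℂ, s • u + t • w = 0 → s = 0 ∧ t = 0)
    {S T : Plane →L[ℂ] Plane} (hu : S u = T u) (hw : S w = T w) : S = T := by
  ext1 x
  obtain ⟨a, b, rfl⟩ := exists_eq_add h x
  simp [hu, hw]

theorem Plane.zero_smul_clm (S : Plane →L[ℂ] Plane) : (0 : ℂ) • S = 0 :=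
  zero_smul ℂ S

theorem anticomm_apply {S T : Plane →L[ℂ] Plane} (h : S * T = -(T * S)) (x : Plane) :
    S (T x) = -T (S x) := congrArg (fun f : Plane →L[ℂ] Plane => f x) h

theorem isUnit_injective {S : Plane →L[ℂ] Plane} (hS : IsUnit S) {x : Plane} (hx : S x = 0) :
    x = 0 :=
  (ContinuousLinearMap.isUnit_iff_bijective.1 hS).1 (hx.trans (map_zero S).symm)

theorem exists_ker_of_not_isUnit {S : Plane →L[ℂ] Plane} (hS : ¬ IsUnit S) :
    ∃ u : Plane, u ≠ 0 ∧ S u = 0 := by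
  by_contra! h
  refine hS (ContinuousLinearMap.isUnit_iff_bijective.2 ?_)
  have hinj : Function.Injective S.toLinearMap :=
    (injective_iff_map_eq_zero S.toLinearMap).2 fun x hx => by
      by_contra h0
      exact h x h0 hx
  exact ⟨hinj, LinearMap.injective_iff_surjective.1 hinj⟩

/-- If a singular `A` has nonzero square, then of two operators that anticommute with `A` and with
each other, one vanishes. -/
theorem eq_zero_or_eq_zero_of_sq_ne_zero {A S T : Plane →L[ℂ] Plane} (hA : ¬ IsUnit A)
    (hA2 : A * A ≠ 0) (hS : A * S = -(S * A)) (hT : A * T = -(T * A)) (hST : S * T = -(T * S)) :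
    S = 0 ∨ T = 0 := by
  obtain ⟨u, hu, hAu⟩ := exists_ker_of_not_isUnit hA
  obtain ⟨v, hv⟩ : ∃ v, A (A v) ≠ 0 := by
    by_contra! h
    exact hA2 (ContinuousLinearMap.ext h)
  obtain ⟨w, hw⟩ : ∃ w, w = A v := ⟨_, rfl⟩
  rw [← hw] at hv
  have hw0 : w ≠ 0 := fun h => hv (by rw [h, map_zero])
  have hli : ∀ s t : ℂ, s • u + t • w = 0 → s = 0 ∧ t = 0 := fun s t h => by
    have h1 := congrArg A h
    rw [map_add, map_smul, map_smul, hAu, smul_zero, zero_add, map_zero] at h1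
    have ht := (smul_eq_zero.1 h1).resolve_right hv
    rw [ht, zero_smul, add_zero] at h
    exact ⟨(smul_eq_zero.1 h).resolve_right hu, ht⟩
  obtain ⟨t, ht, hAw⟩ : ∃ t : ℂ, t ≠ 0 ∧ A w = t • w := by
    obtain ⟨x, y, hxy⟩ := Plane.exists_eq_add hli v
    have h1 : w = y • A w := by
      have h2 := congrArg A hxy
      rwa [map_add, map_smul, map_smul, hAu, smul_zero, zero_add, ← hw] at h2
    have hy : y ≠ 0 := fun h => hw0 (by rw [h1, h, zero_smul])
    exact ⟨y⁻¹, inv_ne_zero hy, (eq_inv_smul_iff₀ hy).2 h1.symm⟩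
  -- In the eigenbasis `u`, `w` of `A`, with eigenvalues `0` and `t`, the map `R` sends the
  -- `t`-eigenspace into that of `-t`, which is zero, and preserves the kernel.
  have key : ∀ R : Plane →L[ℂ] Plane, A * R = -(R * A) → ∃ p : ℂ, R u = p • u ∧ R w = 0 := by
    intro R hR
    obtain ⟨p, r, h1⟩ := Plane.exists_eq_add hli (R u)
    obtain ⟨p', r', h2⟩ := Plane.exists_eq_add hli (R w)
    have h3 := anticomm_apply hR u
    rw [h1, hAu, map_zero, neg_zero, map_add, map_smul, map_smul, hAu, hAw, smul_zero, zero_add,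
      smul_smul, smul_eq_zero, mul_eq_zero] at h3
    have hr : r = 0 := by tauto
    have h4 := anticomm_apply hR w
    rw [hAw, map_smul, h2, map_add, map_smul, map_smul, hAu, hAw, smul_zero, zero_add] at h4
    have h5 : (t * p') • u + (2 * t * r') • w = 0 := by
      rw [← sub_eq_zero] at h4
      rw [← h4]
      module
    obtain ⟨h6, h7⟩ := hli _ _ h5
    have hp' : p' = 0 := by simpa [ht] using h6
    have hr' : r' = 0 := by simpa [ht] using h7
    exact ⟨p, by rw [h1, hr, zero_smul, add_zero], by rw [h2, hp', hr']; simp⟩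
  obtain ⟨p, hSu, hSw⟩ := key S hS
  obtain ⟨r, hTu, hTw⟩ := key T hT
  have h1 := anticomm_apply hST u
  rw [hSu, hTu, map_smul, map_smul, hSu, hTu, ← sub_eq_zero] at h1
  have h2 : (2 * (p * r)) • u = 0 := by
    rw [← h1]
    module
  have h3 : p = 0 ∨ r = 0 := by simpa [hu] using h2
  rcases h3 with rfl | rfl
  · exact .inl (Plane.clm_ext hli (by simpa using hSu) (by simpa using hSw))
  · exact .inr (Plane.clm_ext hli (by simpa using hTu) (by simpa using hTw))

/-- Of two operators that anticommute with each other and with a nilpotent `N`, one is a multiple of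
`N`. -/
theorem eq_smul_or_eq_smul_of_sq_eq_zero {N S T : Plane →L[ℂ] Plane} (hN : N ≠ 0)
    (hN2 : N * N = 0) (hS : N * S = -(S * N)) (hT : N * T = -(T * N)) (hST : S * T = -(T * S)) :
    (∃ b : ℂ, S = b • N) ∨ ∃ b : ℂ, T = b • N := by
  obtain ⟨u, hu⟩ : ∃ u, N u ≠ 0 := by
    by_contra! h
    exact hN (ContinuousLinearMap.ext h)
  obtain ⟨w, hw⟩ : ∃ w, w = N u := ⟨_, rfl⟩
  have hNw : N w = 0 := by
    rw [hw]
    exact congrArg (fun f : Plane →L[ℂ] Plane => f u) hN2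
  rw [← hw] at hu
  have hli : ∀ s t : ℂ, s • u + t • w = 0 → s = 0 ∧ t = 0 := fun s t h => by
    have h1 := congrArg N h
    rw [map_add, map_smul, map_smul, hNw, smul_zero, add_zero, map_zero, ← hw] at h1
    have hs := (smul_eq_zero.1 h1).resolve_right hu
    rw [hs, zero_smul, zero_add] at h
    exact ⟨hs, (smul_eq_zero.1 h).resolve_right hu⟩
  -- `R` preserves the line `ker N` spanned by `w`. If it kills `w`, then `N R u = -R w = 0`, so `R
  -- u` is a multiple of `w = N u`.
  have key : ∀ R : Plane →L[ℂ] Plane, N * R = -(R * N) →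
      ∃ c : ℂ, R w = c • w ∧ (c = 0 → ∃ b : ℂ, R = b • N) := by
    intro R hR
    obtain ⟨p, c, h1⟩ := Plane.exists_eq_add hli (R w)
    obtain ⟨a, b, h2⟩ := Plane.exists_eq_add hli (R u)
    have h3 := anticomm_apply hR w
    rw [hNw, map_zero, neg_zero, h1, map_add, map_smul, map_smul, hNw, smul_zero, add_zero, ← hw,
      smul_eq_zero] at h3
    have hp : p = 0 := by tauto
    rw [hp, zero_smul, zero_add] at h1
    refine ⟨c, h1, fun hc => ⟨b, Plane.clm_ext hli ?_ ?_⟩⟩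
    · have h4 := anticomm_apply hR u
      rw [h2, map_add, map_smul, map_smul, hNw, ← hw, h1, hc, zero_smul, neg_zero, smul_zero,
        add_zero, smul_eq_zero] at h4
      have ha : a = 0 := by tauto
      rw [h2, ha, zero_smul, zero_add, smul_apply, hw]
    · rw [h1, hc, zero_smul, smul_apply, hNw, smul_zero]
  obtain ⟨c, hSw, hS'⟩ := key S hS
  obtain ⟨d, hTw, hT'⟩ := key T hT
  have h1 := anticomm_apply hST w
  rw [hSw, hTw, map_smul, map_smul, hSw, hTw, ← sub_eq_zero] at h1
  have h2 : (2 * (c * d)) • w = 0 := by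
    rw [← h1]
    module
  have h3 : c = 0 ∨ d = 0 := by simpa [hu] using h2
  exact h3.imp hS' hT'

/-- An operator that anticommutes with two invertible anticommuting operators is a multiple of their
product. -/
theorem eq_smul_mul_of_anticomm {A B C : Plane →L[ℂ] Plane} (hA : IsUnit A) (hB : IsUnit B)
    (hAB : A * B = -(B * A)) (hAC : A * C = -(C * A)) (hBC : B * C = -(C * B)) :
    ∃ γ : ℂ, C = γ • (A * B) := by
  -- `A` has eigenvectors `v` and `w = B v` for `l` and `-l`. As `C` exchanges these eigenspaces, `C
  -- v` is a multiple of `w`, hence of `A B v`; anti-commutation with `B` determines `C w`.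
  obtain ⟨l, hl⟩ := Module.End.exists_eigenvalue A.toLinearMap
  obtain ⟨v, hv⟩ := hl.exists_hasEigenvector
  have hv0 : v ≠ 0 := hv.2
  have hAv : A v = l • v := hv.apply_eq_smul
  have hl0 : l ≠ 0 := fun h => hv0 (isUnit_injective hA (by rw [hAv, h, zero_smul]))
  obtain ⟨w, hw⟩ : ∃ w, w = B v := ⟨_, rfl⟩
  have hw0 : w ≠ 0 := fun h => hv0 (isUnit_injective hB (by rw [← hw, h]))
  have hAw : A w = -(l • w) := by rw [hw, anticomm_apply hAB, hAv, map_smul]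
  have hli : ∀ s t : ℂ, s • v + t • w = 0 → s = 0 ∧ t = 0 := fun s t h => by
    have h1 := congrArg A h
    rw [map_add, map_smul, map_smul, hAv, hAw, map_zero] at h1
    have h2 : (2 * l * s) • v = 0 := by
      have : (2 * l * s) • v = l • (s • v + t • w) + (s • l • v + t • -(l • w)) := by module
      rw [this, h, h1, smul_zero, add_zero]
    have hs : s = 0 := by simpa [hl0, hv0] using h2
    rw [hs, zero_smul, zero_add] at h
    exact ⟨hs, (smul_eq_zero.1 h).resolve_right hw0⟩
  obtain ⟨p, r, hCv⟩ := Plane.exists_eq_add hli (C v)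
  have hp : p = 0 := by
    have h1 := anticomm_apply hAC v
    rw [hAv, map_smul, hCv, map_add, map_smul, map_smul, hAv, hAw, ← sub_eq_zero] at h1
    have h2 : (2 * l * p) • v = 0 := by
      rw [← h1]
      module
    simpa [hl0, hv0] using h2
  rw [hp, zero_smul, zero_add] at hCv
  have hCv' : C v = (-r / l) • A (B v) := by
    rw [hCv, ← hw, hAw, smul_neg, ← neg_smul, smul_smul]
    congr 1
    field_simp
  refine ⟨-r / l, Plane.clm_ext hli hCv' ?_⟩
  change C w = (-r / l) • A (B w)
  have h1 : C (B v) = -B (C v) := by rw [anticomm_apply hBC, neg_neg]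
  rw [hw, h1, hCv', map_smul, ← smul_neg, anticomm_apply hAB (B v)]

/-- Both `C` and `D` are multiples of `AB`, so they commute as well as anti-commute, and `(AB)²` is
invertible. -/
theorem eq_zero_or_eq_zero_of_anticomm {A B C D : Plane →L[ℂ] Plane} (hA : IsUnit A)
    (hB : IsUnit B) (hAB : A * B = -(B * A)) (hAC : A * C = -(C * A)) (hBC : B * C = -(C * B))
    (hAD : A * D = -(D * A)) (hBD : B * D = -(D * B)) (hCD : C * D = -(D * C)) :
    C = 0 ∨ D = 0 := by
  obtain ⟨γ, rfl⟩ := eq_smul_mul_of_anticomm hA hB hAB hAC hBC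
  obtain ⟨δ, rfl⟩ := eq_smul_mul_of_anticomm hA hB hAB hAD hBD
  have h1 : (2 * (γ * δ)) • (A * B * (A * B)) = 0 := by
    rw [smul_mul_smul_comm, smul_mul_smul_comm, ← sub_eq_zero] at hCD
    rw [← hCD]
    module
  have h2 : A * B * (A * B) ≠ 0 := ((hA.mul hB).mul (hA.mul hB)).ne_zero
  have h3 : γ = 0 ∨ δ = 0 := by
    have := (smul_eq_zero.1 h1).resolve_right h2
    simpa using this
  rcases h3 with rfl | rfl
  · exact .inl (Plane.zero_smul_clm _)
  · exact .inr (Plane.zero_smul_clm _)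

end PlaneOperators

/-! ### Reducing tuples to words, and the three parts of the theorem -/

section Tuples

variable {k : ℕ}

/-- The tuple is dilated by unitaries that commute or anticommute according to words. -/
def SignDilated (T : Fin k → Plane →L[ℂ] Plane) : Prop :=
  ∃ s : Fin k → Letter, UnitarilyDilated (fun i j => Letter.sign (-1) (s i) (s j)) T

theorem unitarilyDilated_smul_eval {A B : Plane →L[ℂ] Plane} (hA : ‖A‖ ≤ 1) (hB : ‖B‖ ≤ 1)
    (hAB : A * B = -(B * A)) {T : Fin k → Plane →L[ℂ] Plane} (s : Fin k → Letter) (c : Fin k → ℂ)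
    (hc : ∀ i, ‖c i‖ ≤ 1) (hT : ∀ i, T i = c i • (s i).eval A B) :
    UnitarilyDilated (fun i j => Letter.sign (-1) (s i) (s j)) T := by
  rw [funext hT]
  exact (unitarilyDilated_eval A B hA hB (-1) (by norm_num) (by rw [hAB, neg_one_smul]) s).smul c hc

theorem signDilated_of_forall_exists {A B : Plane →L[ℂ] Plane} (hA : ‖A‖ ≤ 1) (hB : ‖B‖ ≤ 1)
    (hAB : A * B = -(B * A)) {T : Fin k → Plane →L[ℂ] Plane}
    (hT : ∀ i, ∃ (s : Letter) (c : ℂ), ‖c‖ ≤ 1 ∧ T i = c • s.eval A B) : SignDilated T := by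
  choose s c hc hT using hT
  exact ⟨s, unitarilyDilated_smul_eval hA hB hAB s c hc hT⟩

theorem IsAntiCommuting.eq_neg {T : Fin k → Plane →L[ℂ] Plane} (hT : IsAntiCommuting T)
    {i j : Fin k} (hij : i ≠ j) : T i * T j = -(T j * T i) := by
  rcases hij.lt_or_gt with h | h
  · exact hT i j h
  · rw [hT j i h, neg_neg]

theorem signDilated_of_two {T : Fin k → Plane →L[ℂ] Plane} (hcontr : ∀ j, ‖T j‖ ≤ 1)
    (hanti : IsAntiCommuting T) (i j : Fin k) (h : ∀ l, l ≠ i → l ≠ j → T l = 0) :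
    SignDilated T := by
  rcases eq_or_ne i j with rfl | hij
  -- Zero entries cost nothing: each is the scalar `0` times an arbitrary word.
  · refine signDilated_of_forall_exists (hcontr i) (B := 0) (by simp) (by simp) fun l => ?_
    rcases eq_or_ne l i with rfl | hl
    · exact ⟨.a, 1, by simp, by simp [Letter.eval]⟩
    · exact ⟨.a, 0, by simp, (h l hl hl).trans (Plane.zero_smul_clm _).symm⟩
  · refine signDilated_of_forall_exists (hcontr i) (hcontr j) (hanti.eq_neg hij) fun l => ?_
    rcases eq_or_ne l i with rfl | hl
    · exact ⟨.a, 1, by simp, by simp [Letter.eval]⟩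
    rcases eq_or_ne l j with rfl | hl'
    · exact ⟨.b, 1, by simp, by simp [Letter.eval]⟩
    · exact ⟨.a, 0, by simp, (h l hl hl').trans (Plane.zero_smul_clm _).symm⟩

theorem signDilated_of_not_isUnit {T : Fin k → Plane →L[ℂ] Plane} (hcontr : ∀ j, ‖T j‖ ≤ 1)
    (hanti : IsAntiCommuting T) (j : Fin k) (hj : T j ≠ 0) (hj' : ¬ IsUnit (T j)) :
    SignDilated T := by
  by_cases h2 : T j * T j = 0
  · have hn : ‖T j‖ ≠ 0 := norm_ne_zero_iff.2 hj
    -- Normalising to norm one makes the coefficient of any contraction `b • T j` along `B` have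
    -- modulus at most one.
    obtain ⟨B, hB⟩ : ∃ B, B = ((‖T j‖⁻¹ : ℝ) : ℂ) • T j := ⟨_, rfl⟩
    have hB1 : ‖B‖ = 1 := by
      rw [hB, norm_smul, Complex.norm_real, norm_inv, norm_norm, inv_mul_cancel₀ hn]
    have hTB : T j = (‖T j‖ : ℂ) • B := by
      rw [hB, smul_smul, ← Complex.ofReal_mul, mul_inv_cancel₀ hn, Complex.ofReal_one, one_smul]
    have hmul : ∀ l, (∃ b : ℂ, T l = b • T j) → ∃ c : ℂ, ‖c‖ ≤ 1 ∧ T l = c • B := by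
      rintro l ⟨b, hb⟩
      refine ⟨b * ‖T j‖, ?_, by rw [← smul_smul, ← hTB, hb]⟩
      rw [norm_mul, Complex.norm_real, norm_norm, ← norm_smul, ← hb]
      exact hcontr l
    -- At most one entry is not a multiple of `T j`; that entry and `B` then generate the tuple.
    by_cases h : ∃ i, ¬ ∃ b : ℂ, T i = b • T j
    · obtain ⟨i, hi⟩ := h
      have hij : i ≠ j := fun h => hi ⟨1, by rw [h, one_smul]⟩
      refine signDilated_of_forall_exists (hcontr i) hB1.le ?_ fun l => ?_
      · rw [hB, mul_smul_comm, smul_mul_assoc, hanti.eq_neg hij, smul_neg]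
      · rcases eq_or_ne l i with rfl | hl
        · exact ⟨.a, 1, by simp, by simp [Letter.eval]⟩
        · have hlj : ∃ b : ℂ, T l = b • T j := by
            rcases eq_or_ne l j with rfl | hlj
            · exact ⟨1, (one_smul _ _).symm⟩
            · exact (eq_smul_or_eq_smul_of_sq_eq_zero hj h2 (hanti.eq_neg hlj.symm)
                (hanti.eq_neg hij.symm) (hanti.eq_neg hl)).resolve_right hi
          obtain ⟨c, hc, hl⟩ := hmul l hlj
          exact ⟨.b, c, hc, hl⟩
    · push Not at h
      refine signDilated_of_forall_exists (A := 0) (by simp) hB1.le (by simp) fun l => ?_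
      obtain ⟨c, hc, hl⟩ := hmul l (h l)
      exact ⟨.b, c, hc, hl⟩
  · by_cases h : ∃ i, i ≠ j ∧ T i ≠ 0
    · obtain ⟨i, hij, hi⟩ := h
      refine signDilated_of_two hcontr hanti j i fun l hlj hli => ?_
      exact (eq_zero_or_eq_zero_of_sq_ne_zero hj' h2 (hanti.eq_neg hlj.symm)
        (hanti.eq_neg hij.symm) (hanti.eq_neg hli)).resolve_right hi
    · push Not at h
      exact signDilated_of_two hcontr hanti j j fun l hl _ => h l hl

/-- Only when all non-zero entries are invertible and two besides `T n` are non-zero is a factor `β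
≠ 1` ever used: `T n` is then `β` times the product of those two, and all further entries vanish. -/
theorem exists_smul_signDilated {T : Fin k → Plane →L[ℂ] Plane} (hcontr : ∀ j, ‖T j‖ ≤ 1)
    (hanti : IsAntiCommuting T) (n : Fin k) (hn : T n ≠ 0) :
    ∃ β : ℂ, β ≠ 0 ∧ SignDilated (Function.update T n (β⁻¹ • T n)) := by
  have hone : SignDilated T → ∃ β : ℂ, β ≠ 0 ∧ SignDilated (Function.update T n (β⁻¹ • T n)) :=
    fun h => ⟨1, one_ne_zero, by simpa using h⟩
  by_cases h1 : ∃ j, T j ≠ 0 ∧ ¬ IsUnit (T j)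
  · obtain ⟨j, hj, hj'⟩ := h1
    exact hone (signDilated_of_not_isUnit hcontr hanti j hj hj')
  push Not at h1
  by_cases h2 : ∃ i, i ≠ n ∧ T i ≠ 0
  swap
  · push Not at h2
    exact hone (signDilated_of_two hcontr hanti n n fun l hl _ => h2 l hl)
  obtain ⟨i, hin, hi⟩ := h2
  by_cases h3 : ∃ l, l ≠ n ∧ l ≠ i ∧ T l ≠ 0
  swap
  · push Not at h3
    exact hone (signDilated_of_two hcontr hanti n i h3)
  obtain ⟨l, hln, hli, hl⟩ := h3
  obtain ⟨β, hβ⟩ := eq_smul_mul_of_anticomm (h1 i hi) (h1 l hl) (hanti.eq_neg hli.symm)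
    (hanti.eq_neg hin) (hanti.eq_neg hln)
  have hβ0 : β ≠ 0 := fun h => hn (by rw [hβ, h]; exact Plane.zero_smul_clm _)
  refine ⟨β, hβ0, signDilated_of_forall_exists (hcontr i) (hcontr l) (hanti.eq_neg hli.symm)
    fun m => ?_⟩
  rcases eq_or_ne m n with rfl | hmn
  · refine ⟨.ab, 1, by simp, ?_⟩
    rw [Function.update_self, hβ, smul_smul, inv_mul_cancel₀ hβ0]
    rfl
  rw [Function.update_of_ne hmn]
  rcases eq_or_ne m i with rfl | hmi
  · exact ⟨.a, 1, by simp, by simp [Letter.eval]⟩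
  rcases eq_or_ne m l with rfl | hml
  · exact ⟨.b, 1, by simp, by simp [Letter.eval]⟩
  · have : T m = 0 := (eq_zero_or_eq_zero_of_anticomm (h1 i hi) (h1 l hl) (hanti.eq_neg hli.symm)
      (hanti.eq_neg hmi.symm) (hanti.eq_neg hml.symm) (hanti.eq_neg hin) (hanti.eq_neg hln)
      (hanti.eq_neg hmn)).resolve_right hn
    exact ⟨.a, 0, by simp, this.trans (Plane.zero_smul_clm _).symm⟩

theorem le_three_of_isUnit {T : Fin k → Plane →L[ℂ] Plane} (hanti : IsAntiCommuting T)
    (h : ∀ j, IsUnit (T j)) : k ≤ 3 := by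
  by_contra! hk
  have hne : ∀ a b : ℕ, ∀ (ha : a < k) (hb : b < k), a ≠ b → (⟨a, ha⟩ : Fin k) ≠ ⟨b, hb⟩ :=
    fun a b ha hb hab h => hab (Fin.mk.inj h)
  have key := eq_zero_or_eq_zero_of_anticomm (h ⟨0, by omega⟩) (h ⟨1, by omega⟩)
    (C := T ⟨2, by omega⟩) (D := T ⟨3, by omega⟩)
    (hanti.eq_neg (hne _ _ _ _ (by omega))) (hanti.eq_neg (hne _ _ _ _ (by omega)))
    (hanti.eq_neg (hne _ _ _ _ (by omega))) (hanti.eq_neg (hne _ _ _ _ (by omega)))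
    (hanti.eq_neg (hne _ _ _ _ (by omega))) (hanti.eq_neg (hne _ _ _ _ (by omega)))
  exact key.elim (h _).ne_zero (h _).ne_zero

theorem exists_antiCommuting_dilation {T : Fin 3 → Plane →L[ℂ] Plane} (hcontr : ∀ j, ‖T j‖ ≤ 1)
    (hanti : IsAntiCommuting T) (h : ∀ j, IsUnit (T j)) (hle : ‖T 0‖ ≤ ‖T 1 * T 2‖) :
    UnitarilyDilated (fun _ _ => -1) T := by
  have h12 := hanti.eq_neg (i := 1) (j := 2) (by decide)
  obtain ⟨γ, hγ⟩ := eq_smul_mul_of_anticomm (h 1) (h 2) h12 (hanti.eq_neg (j := 0) (by decide))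
    (hanti.eq_neg (j := 0) (by decide))
  have hpos : 0 < ‖T 1 * T 2‖ := norm_pos_iff.2 ((h 1).mul (h 2)).ne_zero
  -- Since `‖T 0‖ = |γ| ‖T 1 * T 2‖`, the norm hypothesis amounts to `|γ| ≤ 1`.
  have hγ1 : ‖γ‖ ≤ 1 := by
    rw [hγ, norm_smul] at hle
    exact le_of_mul_le_mul_right (by rwa [one_mul]) hpos
  obtain ⟨K, i1, i2, i3, U, J, hU, hJ⟩ := unitarilyDilated_smul_eval (T := T) (hcontr 1) (hcontr 2)
    h12 ![.ab, .a, .b] ![γ, 1, 1] (by simpa [Fin.forall_fin_succ] using hγ1) (by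
      simpa [Fin.forall_fin_succ, Letter.eval] using hγ)
  refine ⟨K, i1, i2, i3, U, J, fun i j hij x => ?_, hJ⟩
  rw [hU i j hij x]
  -- The words `ab`, `a`, `b` are pairwise distinct, so every sign is `-1`.
  fin_cases i <;> fin_cases j <;> first | rfl | exact absurd hij (by decide)

theorem Letter.sign_neg_one_eq (s t : Letter) : sign (-1) s t = 1 ∨ sign (-1) s t = -1 := by
  cases s <;> cases t <;> simp [sign]

theorem Letter.sign_comm (ε : ℂ) (s t : Letter) : sign ε s t = sign ε t s := by
  cases s <;> cases t <;> rfl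

theorem SignDilated.exists_dilates {T : Fin k → Plane →L[ℂ] Plane} (hT : SignDilated T) :
    ∃ (K : Type) (_ : NormedAddCommGroup K) (_ : InnerProductSpace ℂ K) (_ : CompleteSpace K)
      (U : Fin k → K →L[ℂ] K) (q : Fin k → Fin k → ℂ),
      (∀ j, U j ∈ unitary (K →L[ℂ] K)) ∧ IsQCommuting q U ∧ IsSignFamily q ∧ Dilates U T := by
  obtain ⟨s, hs⟩ := hT
  obtain ⟨K, i1, i2, i3, U, hU, hq, hd⟩ := hs.exists_dilates
  refine ⟨K, i1, i2, i3, U, _, hU, fun i j hij => ⟨?_, ?_, hq i j hij⟩,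
    fun i j _ => Letter.sign_neg_one_eq _ _, hd⟩
  · rcases Letter.sign_neg_one_eq (s i) (s j) with h | h <;> simp [h]
  · rw [Letter.sign_comm _ (s j)]
    rcases Letter.sign_neg_one_eq (s i) (s j) with h | h <;> norm_num [h]

end Tuples

theorem mainTheorem3 (k : ℕ) [NeZero k]
    (T : Fin k → EuclideanSpace ℂ (Fin 2) →L[ℂ] EuclideanSpace ℂ (Fin 2))
    (hcontr : ∀ j, ‖T j‖ ≤ 1) (hanti : IsAntiCommuting T) :
    (T 0 ≠ 0 →
      ∃ (K : Type) (_ : NormedAddCommGroup K) (_ : InnerProductSpace ℂ K) (_ : CompleteSpace K)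
        (U : Fin k → K →L[ℂ] K) (q : Fin k → Fin k → ℂ) (β : ℂ),
        (∀ j, U j ∈ unitary (K →L[ℂ] K)) ∧ IsQCommuting q U ∧ IsSignFamily q ∧ β ≠ 0 ∧
          Dilates (Function.update U 0 (β • U 0)) T) ∧
    ((∃ j, T j ≠ 0 ∧ ¬ IsUnit (T j)) →
      ∃ (K : Type) (_ : NormedAddCommGroup K) (_ : InnerProductSpace ℂ K) (_ : CompleteSpace K)
        (U : Fin k → K →L[ℂ] K) (q : Fin k → Fin k → ℂ),
        (∀ j, U j ∈ unitary (K →L[ℂ] K)) ∧ IsQCommuting q U ∧ IsSignFamily q ∧ Dilates U T) ∧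
    ((∀ j, IsUnit (T j)) →
      k ≤ 3 ∧
      ∀ h : k = 3,
        ‖T (Fin.cast h.symm 0)‖ ≤ ‖T (Fin.cast h.symm 1) * T (Fin.cast h.symm 2)‖ →
        ∃ (K : Type) (_ : NormedAddCommGroup K) (_ : InnerProductSpace ℂ K) (_ : CompleteSpace K)
          (U : Fin k → K →L[ℂ] K),
          (∀ j, U j ∈ unitary (K →L[ℂ] K)) ∧ IsAntiCommuting U ∧ Dilates U T) := by
  refine ⟨fun h0 => ?_, ?_, fun hu => ⟨le_three_of_isUnit hanti hu, ?_⟩⟩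
  · obtain ⟨β, hβ, hs⟩ := exists_smul_signDilated hcontr hanti 0 h0
    obtain ⟨K, i1, i2, i3, U, q, hU, hq, hq', hd⟩ := hs.exists_dilates
    refine ⟨K, i1, i2, i3, U, q, β, hU, hq, hq', hβ, ?_⟩
    simpa [smul_smul, mul_inv_cancel₀ hβ] using hd.update_smul 0 β
  · rintro ⟨j, hj, hj'⟩
    exact (signDilated_of_not_isUnit hcontr hanti j hj hj').exists_dilates
  · intro h hle
    subst h
    obtain ⟨K, i1, i2, i3, U, hU, hq, hd⟩ :=
      (exists_antiCommuting_dilation hcontr hanti hu hle).exists_dilates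
    refine ⟨K, i1, i2, i3, U, hU, fun i j hij => ?_, hd⟩
    rw [hq i j hij, neg_one_smul]
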